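/- **System.** $N$ flows of update packets share one queue with an infinite buffer and $M$ servers. Packet $i$ of flow $n$ is generated at time $S_{n,i}$ and arrives at the queue at time $A_{n,i}$, where $0\le S_{n,1}\le S_{n,2}\le\dots$ and $S_{n,i}\le A_{n,i}$; these times are fixed (given). They are *synchronized*: $S_{n,i}=S_i$ and $A_{n,i}=A_i$ for all $n,i$. Any packet can be assigned to any server, and a server processes one packet at a time. The service times are i.i.d. across the servers and time and do not depend on the policy or on the arrivals; their common law on $[0,\infty)$ is New-Better-than-Used: $\bar F(\tau+t)\le\bar F(\tau)\bar F(t)$ for all $\tau,t\ge0$, where $\bar F(x)=\Pr[X>x]$. $\Pi_{np}$ is the set of non-preemptive causal (possibly randomized) scheduling policies: a server completes its packet before starting another one, and the decisions at time $t$ depend on the service times only through what has been observed by time $t$ (any randomization being independent of the service times). **Ages.** Let $V_{n,i}$ and $D_{n,i}$ be the times at which packet $i$ of flow $n$ starts service and is delivered. Let $a_n\ge 0$ be the age of flow $n$ just before time $0$, the same for all policies. The age and the Age of Served Information of flow $n$ are $$\Delta_n(t)=t-\max\big(\{-a_n\}\cup\{S_{n,i}:D_{n,i}\le t\}\big),\qquad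 \Xi_n(t)=t-\max\big(\{-a_n\}\cup\{S_{n,i}:V_{n,i}\le t\}\big).$$ The non-preemptive MASIF-LGFS policy is work-conserving (no server is idle while a packet is waiting) and non-preemptive, and at each service start it serves the last generated waiting packet of a flow whose Age of Served Information is maximal among the flows with waiting packets; ties are broken arbitrarily. Let $P$ be such a policy, with state processes $\Xi_P,\Delta_P$. **Theorem.** For each $t\ge0$ let $p_t:[0,\infty)^N\to\mathbb R$ be symmetric and non-decreasing. Then: 1. For every $\pi\in\Pi_{np}$, $$\{p_t(\Xi_P(t)),\,t\ge0\}\ \le_{\rm st}\ \{p_t(\Delta_\pi(t)),\,t\ge0\},$$ i.e. for all $0\le t_1<\dots<t_m$ and every upper set $U\subseteq\mathbb R^m$, the probability that $(p_{t_j}(\Xi_P(t_j)))_{j\le m}\in U$ is at most the probability that $(p_{t_j}(\Delta_\pi(t_j)))_{j\le m}\in U$. 2. For every functional $\phi$ on the Lebesgue measurable functions $[0,\infty)\to\mathbb R$ that is non-decreasing for the pointwise order, $$\mathbb E\,\phi(\{p_t(\Xi_P(t))\}_{t\ge0})\ \le\ \inf_{\pi\in\Pi_{np}}\mathbb E\,\phi(\{p_t(\Delta_\pi(t))\}_{t\ge0})\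 \le\ \mathbb E\,\phi(\{p_t(\Delta_P(t))\}_{t\ge0}),$$ provided that the expectations exist: the first inequality holds if the expectation on the left exists, the second if the one on the right exists, and the infimum is over the policies $\pi$ for which the expectation exists (expectations have values in $[-\infty,\infty]$). -/

import Mathlib

open MeasureTheory
open scoped NNReal ENNReal

noncomputable section

namespace StatusUpdate

/-! ### Probabilistic notions -/

/-- A distribution `μ` on `[0, ∞)` is New-Better-than-Used: the complementary distribution function
`F x = μ (x, ∞)` satisfies `F (τ + t) ≤ F τ * F t` for all `τ, t ≥ 0`. -/
def IsNBU (μ : Measure ℝ≥0) : Prop :=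
  ∀ τ t : ℝ≥0, μ (Set.Ioi (τ + t)) ≤ μ (Set.Ioi τ) * μ (Set.Ioi t)

/-- Stochastic ordering of two real processes indexed by `[0, ∞)`, possibly living on different
probability spaces: every finite-dimensional vector of the first is stochastically smaller than that
of the second, i.e. it has a smaller probability of lying in any upper set. -/
def StochLE {Ω Ω' : Type*} [MeasurableSpace Ω] [MeasurableSpace Ω']
    (P : Measure Ω) (Y : ℝ≥0 → Ω → ℝ) (P' : Measure Ω') (Y' : ℝ≥0 → Ω' → ℝ) : Prop :=
  ∀ (n : ℕ) (t : Fin n → ℝ≥0), StrictMono t → ∀ U : Set (Fin n → ℝ), IsUpperSet U →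
    P {ω | (fun i => Y (t i) ω) ∈ U} ≤ P' {ω | (fun i => Y' (t i) ω) ∈ U}

/-- The set of Lebesgue measurable functions `[0, ∞) → ℝ`: preimages of Borel sets are measurable
for the completion of Lebesgue measure on `[0, ∞)`. -/
def lebesgueFunctions : Set (ℝ≥0 → ℝ) :=
  {f | NullMeasurable f (Measure.comap ((↑) : ℝ≥0 → ℝ) volume)}

/-- The expectation of `φ` evaluated at the path of the process `Y` exists, as an extended real
number: almost every path is a Lebesgue measurable function, the resulting random variable is
measurable (with respect to the completed probability), and its positive and negative parts do not
both have an infinite integral. -/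
def ExpectationExists {Ω : Type*} [MeasurableSpace Ω] (P : Measure Ω) (φ : (ℝ≥0 → ℝ) → ℝ)
    (Y : ℝ≥0 → Ω → ℝ) : Prop :=
  (∀ᵐ ω ∂P, (fun t => Y t ω) ∈ lebesgueFunctions) ∧
  AEMeasurable (fun ω => φ (fun t => Y t ω)) P ∧
  (∫⁻ ω, ENNReal.ofReal (φ (fun t => Y t ω)) ∂P ≠ ⊤ ∨
    ∫⁻ ω, ENNReal.ofReal (-φ (fun t => Y t ω)) ∂P ≠ ⊤)

/-- The expectation of `φ` evaluated at the path of the process `Y`, as an extended real number: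
the integral of the positive part minus the integral of the negative part. -/
def expectation {Ω : Type*} [MeasurableSpace Ω] (P : Measure Ω) (φ : (ℝ≥0 → ℝ) → ℝ)
    (Y : ℝ≥0 → Ω → ℝ) : EReal :=
  ((∫⁻ ω, ENNReal.ofReal (φ (fun t => Y t ω)) ∂P : ℝ≥0∞) : EReal) -
    ((∫⁻ ω, ENNReal.ofReal (-φ (fun t => Y t ω)) ∂P : ℝ≥0∞) : EReal)

/-- A symmetric and non-decreasing penalty function `[0, ∞)^N → ℝ`. -/
def IsSymmPenalty {N : ℕ} (p : (Fin N → ℝ≥0) → ℝ) : Prop :=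
  (∀ (x : Fin N → ℝ≥0) (e : Equiv.Perm (Fin N)), p (x ∘ e) = p x) ∧ Monotone p

/-! ### The queueing system -/

/-- Packet generation and arrival times of `N` flows: packet `i` of flow `n` is generated at time
`gen n i` and arrives at the queue at time `arr n i` (out-of-order arrivals are allowed). -/
structure Traffic (N : ℕ) where
  gen : Fin N → ℕ → ℝ≥0
  arr : Fin N → ℕ → ℝ≥0
  gen_mono : ∀ n, Monotone (gen n)
  gen_le_arr : ∀ n i, gen n i ≤ arr n i

/-- The generation and arrival times are the same for all flows. -/
def Traffic.Synchronized {N : ℕ} (T : Traffic N) : Prop :=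
  ∃ S A : ℕ → ℝ≥0, ∀ i n, T.gen n i = S i ∧ T.arr n i = A i

/-- A realization of all service times: `x (m, k)` is the duration of the service of the `k`-th
packet (counted from `0`) that is assigned to server `m`. -/
abbrev ServiceTimes (M : ℕ) := Fin M × ℕ → ℝ≥0

/-- A sample point: a seed for the randomization of the policies, and the service times. -/
abbrev Sample (R : Type*) (M : ℕ) := R × ServiceTimes M

/-- The law of the sample point: the service times are i.i.d. with distribution `μ` across servers
and time, and independent of the seed, whose distribution is `ν`. -/
def law {R : Type*} [MeasurableSpace R] (M : ℕ) (ν : Measure R)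
    (μ : Measure ℝ≥0) [IsProbabilityMeasure μ] : Measure (Sample R M) :=
  ν.prod (Measure.infinitePi fun _ : Fin M × ℕ => μ)

/-- What the servers do on one sample path. The service starts are listed in the order in which
they take place: the `k`-th one assigns packet `pkt k` of flow `flow k` to server `server k` at time
`start k`. If `start k = ⊤`, there is no `k`-th service start (and the other entries mean nothing). -/
structure Schedule (N M : ℕ) where
  start : ℕ → ℝ≥0∞
  server : ℕ → Fin M
  flow : ℕ → Fin N
  pkt : ℕ → ℕ

namespace Schedule

variable {N M : ℕ}

/-- The service time that is used by the `k`-th service start: the one with index `(m, l)`, if this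
start assigns to server `m` its `l`-th packet. -/
def slot (σ : Schedule N M) (k : ℕ) : Fin M × ℕ :=
  (σ.server k, ((Finset.range k).filter fun j => σ.server j = σ.server k).card)

/-- The time at which the `k`-th started service is completed. -/
def finish (σ : Schedule N M) (x : ServiceTimes M) (k : ℕ) : ℝ≥0∞ :=
  σ.start k + (x (σ.slot k) : ℝ≥0∞)

/-- The schedule can be carried out without preemption: the starts are listed in order of time, only
packets that have arrived are served, no packet is served twice, and a server that gets a packet
has completed all packets that were assigned to it before. -/
structure Feasible (σ : Schedule N M) (T : Traffic N) (x : ServiceTimes M) : Prop where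
  start_mono : Monotone σ.start
  arrived : ∀ k, σ.start k ≠ ⊤ → (T.arr (σ.flow k) (σ.pkt k) : ℝ≥0∞) ≤ σ.start k
  served_once : ∀ j k, j < k → σ.start k ≠ ⊤ → ¬ (σ.flow j = σ.flow k ∧ σ.pkt j = σ.pkt k)
  nonpreemptive : ∀ j k, j < k → σ.start k ≠ ⊤ → σ.server j = σ.server k →
    σ.finish x j ≤ σ.start k

/-- The time `V n i` at which packet `i` of flow `n` starts service (`⊤` if never). -/
def serviceStart (σ : Schedule N M) (n : Fin N) (i : ℕ) : ℝ≥0∞ :=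
  ⨅ (k : ℕ) (_ : σ.flow k = n ∧ σ.pkt k = i), σ.start k

/-- The time `D n i` at which packet `i` of flow `n` is delivered (`⊤` if never). -/
def delivery (σ : Schedule N M) (x : ServiceTimes M) (n : Fin N) (i : ℕ) : ℝ≥0∞ :=
  ⨅ (k : ℕ) (_ : σ.flow k = n ∧ σ.pkt k = i), σ.finish x k

/-- The age vector at time `t`: time elapsed since the generation of the freshest delivered packet.
Here `a n` is the age of flow `n` just before time `0`, so what is known initially about flow `n`
dates from time `-a n`. -/
def age (σ : Schedule N M) (T : Traffic N) (a : Fin N → ℝ≥0) (x : ServiceTimes M) (t : ℝ≥0) :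
    Fin N → ℝ≥0 := fun n =>
  Real.toNNReal ((t : ℝ) -
    sSup (insert (-(a n : ℝ)) {s | ∃ i, σ.delivery x n i ≤ t ∧ s = (T.gen n i : ℝ)}))

/-- The Age of Served Information vector at time `t`: time elapsed since the generation of the
freshest packet that has started service. -/
def servedAge (σ : Schedule N M) (T : Traffic N) (a : Fin N → ℝ≥0) (t : ℝ≥0) : Fin N → ℝ≥0 :=
  fun n => Real.toNNReal ((t : ℝ) -
    sSup (insert (-(a n : ℝ)) {s | ∃ i, σ.serviceStart n i ≤ t ∧ s = (T.gen n i : ℝ)}))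

/-- After the first `k` service starts, packet `i` of flow `n` is waiting in the queue at time `t`. -/
def Waiting (σ : Schedule N M) (T : Traffic N) (k : ℕ) (t : ℝ≥0∞) (n : Fin N) (i : ℕ) : Prop :=
  (T.arr n i : ℝ≥0∞) ≤ t ∧ ∀ j < k, ¬ (σ.flow j = n ∧ σ.pkt j = i)

/-- After the first `k` service starts, server `m` is idle at time `t`. -/
def Idle (σ : Schedule N M) (x : ServiceTimes M) (k : ℕ) (t : ℝ≥0∞) (m : Fin M) : Prop :=
  ∀ j < k, σ.server j = m → σ.finish x j ≤ t

/-- Work conservation: whenever a packet is waiting and a server is idle, the next service start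
takes place without delay. -/
def WorkConserving (σ : Schedule N M) (T : Traffic N) (x : ServiceTimes M) : Prop :=
  ∀ (k : ℕ) (t : ℝ≥0), (∀ j < k, σ.start j ≤ t) → (∃ m, σ.Idle x k t m) →
    (∃ n i, σ.Waiting T k t n i) → σ.start k ≤ t

/-- The Age of Served Information of flow `n` at the time `t` of the `k`-th service start,
immediately before this start (so earlier starts at the same time are taken into account). -/
def servedAgeBefore (σ : Schedule N M) (T : Traffic N) (a : Fin N → ℝ≥0) (k : ℕ) (n : Fin N) : ℝ :=
  (σ.start k).toReal -
    sSup (insert (-(a n : ℝ)) {s | ∃ j < k, σ.flow j = n ∧ s = (T.gen n (σ.pkt j) : ℝ)})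

/-- Each service start takes the last generated waiting packet of a flow whose Age of Served
Information is maximal among the flows with waiting packets. Ties are broken arbitrarily. -/
def SelectsMASIFLGFS (σ : Schedule N M) (T : Traffic N) (a : Fin N → ℝ≥0) : Prop :=
  ∀ k, σ.start k ≠ ⊤ →
    (∀ n i, σ.Waiting T k (σ.start k) n i →
      σ.servedAgeBefore T a k n ≤ σ.servedAgeBefore T a k (σ.flow k)) ∧
    (∀ i, σ.Waiting T k (σ.start k) (σ.flow k) i →
      T.gen (σ.flow k) i ≤ T.gen (σ.flow k) (σ.pkt k))

end Schedule

/-- A non-preemptive causal scheduling policy for `M` servers, possibly randomized through a seed in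
`R`. Causality: the time and the content of the `k`-th service start depend on the service times
only through what has been observed by that time, namely the durations of the services completed by
then, and the fact that the other services are still in progress. -/
structure Policy {N : ℕ} (T : Traffic N) (M : ℕ) (R : Type*) [MeasurableSpace R] where
  run : Sample R M → Schedule N M
  measurable_start : ∀ k, Measurable fun ω => (run ω).start k
  measurable_server : ∀ k, Measurable fun ω => (run ω).server k
  measurable_flow : ∀ k, Measurable fun ω => (run ω).flow k
  measurable_pkt : ∀ k, Measurable fun ω => (run ω).pkt k
  feasible : ∀ ω, (run ω).Feasible T ω.2
  causal : ∀ (r : R) (x x' : ServiceTimes M) (k : ℕ),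
    (∀ j < k, x ((run (r, x)).slot j) = x' ((run (r, x)).slot j) ∨
      ((run (r, x)).start k < (run (r, x)).start j + (x ((run (r, x)).slot j) : ℝ≥0∞) ∧
        (run (r, x)).start k < (run (r, x)).start j + (x' ((run (r, x)).slot j) : ℝ≥0∞))) →
    (run (r, x')).start k = (run (r, x)).start k ∧
    (run (r, x')).server k = (run (r, x)).server k ∧
    (run (r, x')).flow k = (run (r, x)).flow k ∧
    (run (r, x')).pkt k = (run (r, x)).pkt k

namespace Policy

variable {N : ℕ} {T : Traffic N} {M : ℕ} {R : Type*} [MeasurableSpace R]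

/-- The policy is a non-preemptive Maximum Age of Served Information first, Last Generated First
Served policy, for initial ages `a`. -/
def IsMASIFLGFS (π : Policy T M R) (a : Fin N → ℝ≥0) : Prop :=
  ∀ ω, (π.run ω).WorkConserving T ω.2 ∧ (π.run ω).SelectsMASIFLGFS T a

/-- The age penalty process of the policy. -/
def agePenalty (π : Policy T M R) (a : Fin N → ℝ≥0) (p : ℝ≥0 → (Fin N → ℝ≥0) → ℝ)
    (t : ℝ≥0) (ω : Sample R M) : ℝ :=
  p t ((π.run ω).age T a ω.2 t)

/-- The penalty process of the Age of Served Information of the policy. -/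
def servedAgePenalty (π : Policy T M R) (a : Fin N → ℝ≥0) (p : ℝ≥0 → (Fin N → ℝ≥0) → ℝ)
    (t : ℝ≥0) (ω : Sample R M) : ℝ :=
  p t ((π.run ω).servedAge T a t)

end Policy

end StatusUpdate

end

/-!
Fix the seed `r` of the randomization. From the service times `x` of the system with policy `P`, and
independent auxiliary randomness, service times `x'` for the system with policy `π` are built one
service start at a time (`coupledIter`, `coupledTimes`). When `π` starts a service at time `τ` on
server `m`, the new service time is chosen as follows (`coupledTime`). If server `m` is in the midst
of a service under `P`, which has lasted for a time `s`, then its residual duration has the law of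
`X - s` given `X > s`. By the NBU property this is stochastically smaller than a fresh service time,
so the new service time can be chosen with law `μ` and at least as long as the residual one
(`IsNBU.exists_residual_coupling`). Otherwise it is chosen independently of everything else.

The service times `x'` are again i.i.d. with law `μ` (`map_coupledTimes`). In the step for start
number `k`, all coordinates of `x` other than the duration of the service in progress are frozen.
By causality, what happened before `τ` does not depend on this duration as long as the service is
still in progress at `τ`. The coupling has not used it before either: an earlier start of `π` on
this server during the same service of `P` would belong to a service that is still in progress at
`τ` (`coupledIter_congr_of_inService`). So only the event `X > s` has been observed, the new value
is a fresh service time, and resampling one coordinate preserves the law of an i.i.d. family.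

On every sample path, `π` completes no service before the service of `P` that was in progress on the
same server when it started. Fix `t` and `c`, and suppose that at time `t` some flow has not been
served any information generated after `c` under `P`. Then as soon as a packet generated after `c`
has arrived, and up to time `t`, some packet is waiting, so by work conservation all servers are
busy under `P`, and the selection rule together with the synchronization makes every start serve
information generated after `c` to a flow that had none (`fresh_of_unsaturated`). Each delivery
under `π` by time `t` of a packet generated after `c` can be matched with the start of `P` on the
same server that comes next after the start of this packet under `π`, and the matching is injective.
So at least as many flows have been served such information under `P` as have received it under `π`
(`ncard_freshFlows_le`). Since this holds for all `c`, the sorted vector of Ages of Served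
Information of `P` is at most the sorted age vector of `π` (`IsSymmPenalty.le_of_card_lt`), and both
parts of the theorem follow from the coupling.
-/

open MeasureTheory
open scoped NNReal ENNReal

noncomputable section

namespace StatusUpdate

/-! ### Comparison of symmetric penalties -/

/-- If below every level `b` the vector `u` has at least as many coordinates as `v`, then the
increasing rearrangement of `u` is dominated by that of `v`, so symmetric non-decreasing functions
are smaller at `u` than at `v`. -/
theorem IsSymmPenalty.le_of_card_lt {N : ℕ} {p : (Fin N → ℝ≥0) → ℝ} (hp : IsSymmPenalty p)
    {u v : Fin N → ℝ≥0}
    (h : ∀ b, (Finset.univ.filter fun n => v n < b).card ≤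
      (Finset.univ.filter fun n => u n < b).card) : p u ≤ p v := by
  rw [← hp.1 u (Tuple.sort u), ← hp.1 v (Tuple.sort v)]
  refine hp.2 fun i => ?_
  by_contra! hlt
  have hu := Tuple.monotone_sort u
  have hv := Tuple.monotone_sort v
  have h1 : (Finset.Iic i).card ≤
      (Finset.univ.filter fun n => v n < (u ∘ Tuple.sort u) i).card :=
    Finset.card_le_card_of_injOn (Tuple.sort v)
      (fun j hj => by
        simp only [Finset.coe_Iic, Set.mem_Iic] at hj
        simpa using (hv hj).trans_lt hlt)
      (Tuple.sort v).injective.injOn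
  have h2 : (Finset.univ.filter fun n => u n < (u ∘ Tuple.sort u) i).card ≤
      (Finset.Iio i).card :=
    Finset.card_le_card_of_injOn (Tuple.sort u).symm
      (fun n hn => by
        simp only [Finset.coe_filter, Finset.mem_univ, true_and, Set.mem_ofPred_eq] at hn
        simp only [Finset.coe_Iio, Set.mem_Iio]
        by_contra! hle
        have := hu hle
        simp only [Function.comp_apply, Equiv.apply_symm_apply] at this
        exact absurd hn (not_lt.2 this))
      (Tuple.sort u).symm.injective.injOn
  have h3 := h1.trans ((h _).trans h2)
  simp only [Fin.card_Iic, Fin.card_Iio] at h3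
  omega

/-! ### Sample-path comparison -/

namespace Schedule

variable {N M : ℕ}

/-- Server `m` is strictly inside its service number `q` at time `τ`: the service has started by
`τ` and is completed only after `τ`. -/
def InService (σ : Schedule N M) (x : ServiceTimes M) (m : Fin M) (τ : ℝ≥0∞) (q : ℕ) : Prop :=
  σ.server q = m ∧ σ.start q ≤ τ ∧ τ < σ.finish x q

/-- At time `t` some flow has not been served any information generated after time `c`. -/
def Unsaturated (σ : Schedule N M) (T : Traffic N) (a : Fin N → ℝ≥0) (t : ℝ≥0∞) (c : ℝ) : Prop :=
  ∃ n, -(a n : ℝ) ≤ c ∧ ∀ k, σ.start k ≤ t → σ.flow k = n → (T.gen n (σ.pkt k) : ℝ) ≤ c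

theorem InService.unique {σ : Schedule N M} {T : Traffic N} {x : ServiceTimes M}
    (hσ : σ.Feasible T x) {m : Fin M} {τ : ℝ≥0∞} {q q' : ℕ} (h : σ.InService x m τ q)
    (h' : σ.InService x m τ q') : q = q' := by
  wlog hlt : q < q' generalizing q q'
  · rcases lt_trichotomy q q' with h1 | h1 | h1
    · exact this h h' h1
    · exact h1
    · exact (this h' h h1).symm
  have h2 := hσ.nonpreemptive q q' hlt
    (ne_top_of_lt (h'.2.1.trans_lt (h'.2.2.trans_le le_top))) (h.1.trans h'.1.symm)
  exact absurd h.2.2 (not_lt.2 (h2.trans h'.2.1))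

section MASIF

variable {T : Traffic N} {a : Fin N → ℝ≥0} {σ : Schedule N M} {x : ServiceTimes M}

/-- While information generated after `c` is missing for some flow although a packet generated
after `c` has arrived, every service start serves information generated after `c` to a flow that
did not have any. This is where the flow selection rule and the synchronization of the flows
enter. -/
theorem fresh_of_unsaturated (hT : T.Synchronized)
    (hsel : σ.SelectsMASIFLGFS T a) (hmono : Monotone σ.start) {t : ℝ≥0} {c : ℝ}
    (hu : σ.Unsaturated T a t c) {n : Fin N} {i p : ℕ} (hi : c < T.gen n i)
    (hip : (T.arr n i : ℝ≥0∞) ≤ σ.start p) (hp : σ.start p ≤ t) :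
    c < T.gen (σ.flow p) (σ.pkt p) ∧ -(a (σ.flow p) : ℝ) ≤ c ∧
      ∀ j < p, σ.flow j = σ.flow p → (T.gen (σ.flow p) (σ.pkt j) : ℝ) ≤ c := by
  obtain ⟨S, A, hSA⟩ := hT
  obtain ⟨n₀, ha₀, hn₀⟩ := hu
  simp only [(hSA _ _).1, (hSA _ _).2] at hi hip hn₀ ⊢
  have hwait : ∀ n', (∀ j < p, σ.flow j = n' → (S (σ.pkt j) : ℝ) ≤ c) →
      σ.Waiting T p (σ.start p) n' i := fun n' hn' =>
    ⟨by rwa [(hSA _ _).2], fun j hj hji => by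
      have := hn' j hj hji.1
      rw [hji.2] at this
      exact absurd hi (not_lt.2 this)⟩
  have hptop : σ.start p ≠ ⊤ := ne_top_of_le_ne_top ENNReal.coe_ne_top hp
  have h0 : ∀ j < p, σ.flow j = n₀ → (S (σ.pkt j) : ℝ) ≤ c := fun j hj hj0 =>
    hn₀ j ((hmono hj.le).trans hp) hj0
  have h1 := (hsel p hptop).1 n₀ i (hwait n₀ h0)
  unfold servedAgeBefore at h1
  simp only [(hSA _ _).1] at h1
  have h2 : sSup (insert (-(a n₀ : ℝ)) {s | ∃ j < p, σ.flow j = n₀ ∧ s = (S (σ.pkt j) : ℝ)})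
      ≤ c := by
    refine csSup_le (Set.insert_nonempty _ _) ?_
    rintro s (rfl | ⟨j, hj, hj0, rfl⟩)
    exacts [ha₀, h0 j hj hj0]
  have hfin : (insert (-(a (σ.flow p) : ℝ))
      {s | ∃ j < p, σ.flow j = σ.flow p ∧ s = (S (σ.pkt j) : ℝ)}).Finite := by
    refine Set.Finite.insert _ (((Set.finite_Iio p).image fun j => (S (σ.pkt j) : ℝ)).subset ?_)
    rintro s ⟨j, hj, -, rfl⟩
    exact ⟨j, hj, rfl⟩
  have h3 := fun s hs => (le_csSup hfin.bddAbove (a := s) hs).trans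
    ((sub_le_sub_iff_left _).1 h1 |>.trans h2)
  have h4 : ∀ j < p, σ.flow j = σ.flow p → (S (σ.pkt j) : ℝ) ≤ c := fun j hj hjp =>
    h3 _ (Or.inr ⟨j, hj, hjp, rfl⟩)
  have h5 := (hsel p hptop).2 i (hwait _ h4)
  simp only [(hSA _ _).1] at h5
  exact ⟨hi.trans_le (by exact_mod_cast h5), h3 _ (Or.inl rfl), h4⟩

/-- If some flow still lacks information generated after `c` at time `t`, then only finitely many
services have started by time `t`: infinitely many starts would involve packets of arbitrarily
high index, hence packets generated after `c`, and then each start satisfies a new flow. -/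
theorem exists_start_gt (hT : T.Synchronized) (hσ : σ.Feasible T x)
    (hsel : σ.SelectsMASIFLGFS T a) {t : ℝ≥0} {c : ℝ}
    (hu : σ.Unsaturated T a t c) {n : Fin N} {i : ℕ} (hi : c < T.gen n i) :
    ∃ p, (t : ℝ≥0∞) < σ.start p := by
  by_contra! hall
  have hfin : ∀ p, σ.start p ≠ ⊤ := fun p => ne_top_of_le_ne_top ENNReal.coe_ne_top (hall p)
  have hinj : Function.Injective fun p => (σ.flow p, σ.pkt p) := by
    intro p q hpq
    simp only [Prod.mk.injEq] at hpq
    rcases lt_trichotomy p q with h | h | h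
    · exact absurd hpq (hσ.served_once p q h (hfin q))
    · exact h
    · exact absurd ⟨hpq.1.symm, hpq.2.symm⟩ (hσ.served_once q p h (hfin p))
  obtain ⟨p₀, hp₀⟩ : ∃ p₀, i ≤ σ.pkt p₀ := by
    by_contra! hlt
    refine Set.infinite_range_of_injective hinj
      ((Set.finite_univ.prod (Set.finite_Iio i)).subset ?_)
    rintro _ ⟨p, rfl⟩
    exact ⟨trivial, hlt p⟩
  have hgen : c < T.gen (σ.flow p₀) (σ.pkt p₀) := by
    obtain ⟨S, A, hSA⟩ := hT
    have h := T.gen_mono n hp₀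
    simp only [(hSA _ _).1] at hi h ⊢
    exact hi.trans_le (by exact_mod_cast h)
  have hfresh := fun m => fresh_of_unsaturated hT hsel hσ.start_mono hu hgen
    ((hσ.arrived p₀ (hfin p₀)).trans (hσ.start_mono (Nat.le_add_right p₀ m))) (hall (p₀ + m))
  refine not_injective_infinite_finite (fun m => σ.flow (p₀ + m)) fun m m' hmm => ?_
  wlog hlt : m < m' generalizing m m'
  · rcases lt_trichotomy m m' with h | h | h
    · exact this m m' hmm h
    · exact h
    · exact (this m' m hmm.symm h).symm
  have h1 := (hfresh m').2.2 (p₀ + m) (by omega) hmm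
  have h2 := (hfresh m).1
  simp only at hmm
  rw [hmm] at h2
  exact absurd h2 (not_lt.2 h1)

/-- By work conservation, all servers are busy as long as a packet generated after `c` is in the
system and some flow lacks information generated after `c`. -/
theorem exists_inService (hT : T.Synchronized) (hσ : σ.Feasible T x)
    (hwc : σ.WorkConserving T x) (hsel : σ.SelectsMASIFLGFS T a) {t : ℝ≥0} {c : ℝ}
    (hu : σ.Unsaturated T a t c) {n : Fin N} {i : ℕ} (hi : c < T.gen n i) {τ : ℝ≥0∞}
    (hiτ : (T.arr n i : ℝ≥0∞) ≤ τ) (hτ : τ ≤ t) (m : Fin M) : ∃ q, σ.InService x m τ q := by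
  classical
  lift τ to ℝ≥0 using ne_top_of_le_ne_top ENNReal.coe_ne_top hτ
  have hex : ∃ p, (τ : ℝ≥0∞) < σ.start p :=
    (exists_start_gt hT hσ hsel hu hi).imp fun p hp => hτ.trans_lt hp
  have hlt : ∀ j < Nat.find hex, σ.start j ≤ τ := fun j hj => not_lt.1 (Nat.find_min hex hj)
  by_contra! hno
  refine absurd (Nat.find_spec hex) (not_lt.2 (hwc _ τ hlt ⟨m, fun j hj hjm => ?_⟩ ?_))
  · by_contra! hbusy
    exact hno j ⟨hjm, hlt j hj, hbusy⟩
  · obtain ⟨n₀, -, hn₀⟩ := hu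
    obtain ⟨S, A, hSA⟩ := hT
    refine ⟨n₀, i, ?_, fun j hj hji => ?_⟩
    · simpa only [(hSA _ _).2] using hiτ
    · have := hn₀ j ((hlt j hj).trans hτ) hji.1
      rw [hji.2] at this
      simp only [(hSA _ _).1] at this hi
      exact absurd hi (not_lt.2 this)

/-- A busy server starts its next service as soon as the current one is completed. -/
theorem exists_start_eq_finish (hT : T.Synchronized) (hσ : σ.Feasible T x)
    (hwc : σ.WorkConserving T x) (hsel : σ.SelectsMASIFLGFS T a) {t : ℝ≥0} {c : ℝ}
    (hu : σ.Unsaturated T a t c) {n : Fin N} {i : ℕ} (hi : c < T.gen n i) {τ : ℝ≥0∞}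
    (hiτ : (T.arr n i : ℝ≥0∞) ≤ τ) {m : Fin M} {q : ℕ} (hq : σ.InService x m τ q)
    (hqt : σ.finish x q ≤ t) : ∃ j, σ.server j = m ∧ σ.start j = σ.finish x q := by
  obtain ⟨j, hjm, hj1, hj2⟩ := exists_inService hT hσ hwc hsel hu hi (hiτ.trans hq.2.2.le) hqt m
  refine ⟨j, hjm, le_antisymm hj1 ?_⟩
  have hjt : σ.start j ≠ ⊤ := ne_top_of_le_ne_top ENNReal.coe_ne_top (hj1.trans hqt)
  have hqtop : σ.start q ≠ ⊤ :=
    ne_top_of_le_ne_top ENNReal.coe_ne_top (hq.2.1.trans (hq.2.2.le.trans hqt))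
  rcases lt_trichotomy j q with h | rfl | h
  · have := hσ.nonpreemptive j q h hqtop (hjm.trans hq.1.symm)
    exact absurd (hj2.trans_le this) (not_lt.2 (hq.2.1.trans hq.2.2.le))
  · exact absurd hj2 (lt_irrefl _)
  · exact hσ.nonpreemptive q j h hjt (hq.1.trans hjm.symm)

end MASIF

variable {T : Traffic N} {a : Fin N → ℝ≥0} {σ σ' : Schedule N M} {x x' : ServiceTimes M}

/-- The flows that have information generated after `c`, according to initial knowledge and to the
packets whose `time` (start or completion of service) is at most `t`. -/
def freshFlows (σ : Schedule N M) (T : Traffic N) (a : Fin N → ℝ≥0) (time : ℕ → ℝ≥0∞)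
    (t : ℝ≥0) (c : ℝ) : Set (Fin N) :=
  {n | c < -(a n : ℝ) ∨ ∃ k, time k ≤ t ∧ σ.flow k = n ∧ c < T.gen n (σ.pkt k)}

/-- The counting argument: the packets generated after `c` that are delivered in `σ'` by time `t`
are matched with distinct service starts of `σ`, each of which satisfies a new flow. -/
theorem ncard_freshFlows_le (hT : T.Synchronized) (hσ : σ.Feasible T x)
    (hwc : σ.WorkConserving T x) (hsel : σ.SelectsMASIFLGFS T a) (hσ' : σ'.Feasible T x')
    (hdom : ∀ k q, σ'.start k ≠ ⊤ → σ.InService x (σ'.server k) (σ'.start k) q →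
      σ.finish x q ≤ σ'.finish x' k) (t : ℝ≥0) (c : ℝ) :
    (σ'.freshFlows T a (σ'.finish x') t c).ncard ≤ (σ.freshFlows T a σ.start t c).ncard := by
  classical
  by_cases hsat : σ.freshFlows T a σ.start t c = Set.univ
  · rw [hsat]
    exact Set.ncard_le_ncard (Set.subset_univ _) Set.finite_univ
  have hu : σ.Unsaturated T a t c := by
    obtain ⟨n, hn⟩ := (Set.ne_univ_iff_exists_notMem _).1 hsat
    simp only [freshFlows, Set.mem_ofPred_eq, not_or, not_lt, not_exists, not_and] at hn
    exact ⟨n, hn.1, hn.2⟩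
  -- a delivery in `σ'` is matched with the next start of `σ` on the same server
  have key : ∀ k, σ'.finish x' k ≤ t → c < T.gen (σ'.flow k) (σ'.pkt k) → ∃ j,
      σ.server j = σ'.server k ∧ σ'.start k < σ.start j ∧ σ.start j ≤ σ'.finish x' k := by
    intro k hk hc
    have hkt : σ'.start k ≤ t := le_self_add.trans hk
    have hktop : σ'.start k ≠ ⊤ := ne_top_of_le_ne_top ENNReal.coe_ne_top hkt
    have harr := hσ'.arrived k hktop
    obtain ⟨q, hq⟩ := exists_inService hT hσ hwc hsel hu hc harr hkt (σ'.server k)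
    have hfin := hdom k q hktop hq
    obtain ⟨j, hj, hje⟩ := exists_start_eq_finish hT hσ hwc hsel hu hc harr hq (hfin.trans hk)
    exact ⟨j, hj, hje ▸ hq.2.2, hje ▸ hfin⟩
  choose! nxt hnxt using key
  have hfresh : ∀ k, σ'.finish x' k ≤ t → c < T.gen (σ'.flow k) (σ'.pkt k) →
      c < T.gen (σ.flow (nxt k)) (σ.pkt (nxt k)) ∧ -(a (σ.flow (nxt k)) : ℝ) ≤ c ∧
      ∀ j < nxt k, σ.flow j = σ.flow (nxt k) →
        (T.gen (σ.flow (nxt k)) (σ.pkt j) : ℝ) ≤ c := by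
    intro k hk hc
    obtain ⟨-, h2, h3⟩ := hnxt k hk hc
    exact fresh_of_unsaturated hT hsel hσ.start_mono hu hc
      ((hσ'.arrived k (h2.trans_le le_top).ne).trans h2.le) (h3.trans hk)
  have hnxt_inj : ∀ k k', σ'.finish x' k ≤ t → c < T.gen (σ'.flow k) (σ'.pkt k) →
      σ'.finish x' k' ≤ t → c < T.gen (σ'.flow k') (σ'.pkt k') → k < k' → nxt k ≠ nxt k' := by
    intro k k' hk hc hk' hc' hlt heq
    obtain ⟨h1, h2, h3⟩ := hnxt k hk hc
    obtain ⟨h1', h2', h3'⟩ := hnxt k' hk' hc'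
    rw [heq] at h1 h3
    have := hσ'.nonpreemptive k k' hlt (h2'.trans_le le_top).ne (h1.symm.trans h1')
    exact absurd (h3.trans this) (not_le.2 h2')
  have hflow_inj : ∀ k k', σ'.finish x' k ≤ t → c < T.gen (σ'.flow k) (σ'.pkt k) →
      σ'.finish x' k' ≤ t → c < T.gen (σ'.flow k') (σ'.pkt k') →
      σ.flow (nxt k) = σ.flow (nxt k') → k = k' := by
    intro k k' hk hc hk' hc' hff
    by_contra hne
    have hne' : nxt k ≠ nxt k' := by
      rcases lt_or_gt_of_ne hne with h | h
      · exact hnxt_inj k k' hk hc hk' hc' h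
      · exact (hnxt_inj k' k hk' hc' hk hc h).symm
    have f1 := hfresh k hk hc
    have f2 := hfresh k' hk' hc'
    rcases lt_or_gt_of_ne hne' with h | h
    · exact absurd f1.1 (not_lt.2 (hff ▸ f2.2.2 _ h hff))
    · exact absurd f2.1 (not_lt.2 (hff ▸ f1.2.2 _ h hff.symm))
  have hk : ∀ n, n ∈ σ'.freshFlows T a (σ'.finish x') t c → ¬ c < -(a n : ℝ) →
      ∃ k, σ'.finish x' k ≤ t ∧ σ'.flow k = n ∧ c < T.gen n (σ'.pkt k) :=
    fun n hn hna => hn.resolve_left hna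
  choose! dlv hdlv using hk
  have hdlv' : ∀ n, n ∈ σ'.freshFlows T a (σ'.finish x') t c → ¬ c < -(a n : ℝ) →
      c < T.gen (σ'.flow (dlv n)) (σ'.pkt (dlv n)) := fun n hn hna => by
    have := hdlv n hn hna
    rw [this.2.1]
    exact this.2.2
  refine Set.ncard_le_ncard_of_injOn
    (fun n => if c < -(a n : ℝ) then n else σ.flow (nxt (dlv n))) ?_ ?_ (Set.toFinite _)
  · intro n hn
    split_ifs with hna
    · exact Or.inl hna
    · obtain ⟨h1, h2, h3⟩ := hdlv n hn hna
      have h4 := hdlv' n hn hna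
      exact Or.inr ⟨_, (hnxt _ h1 h4).2.2.trans h1, rfl, (hfresh _ h1 h4).1⟩
  · intro n hn n' hn' hnn
    beta_reduce at hnn
    split_ifs at hnn with h1 h2 h2
    · exact hnn
    · exact absurd h1 (not_lt.2 (hnn ▸ (hfresh _ (hdlv n' hn' h2).1 (hdlv' n' hn' h2)).2.1))
    · exact absurd h2 (not_lt.2 (hnn ▸ (hfresh _ (hdlv n hn h1).1 (hdlv' n hn h1)).2.1))
    · have := hflow_inj _ _ (hdlv n hn h1).1 (hdlv' n hn h1) (hdlv n' hn' h2).1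
        (hdlv' n' hn' h2) hnn
      rw [← (hdlv n hn h1).2.1, this, (hdlv n' hn' h2).2.1]

theorem Feasible.arr_le_start (hσ : σ.Feasible T x) (k : ℕ) :
    (T.arr (σ.flow k) (σ.pkt k) : ℝ≥0∞) ≤ σ.start k := by
  by_cases h : σ.start k = ⊤
  · rw [h]; exact le_top
  · exact hσ.arrived k h

theorem servedAge_lt_of_mem_freshFlows (hσ : σ.Feasible T x) {t b : ℝ≥0} (hb : 0 < b) {n : Fin N}
    (hn : n ∈ σ.freshFlows T a σ.start t (t - b)) : σ.servedAge T a t n < b := by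
  unfold servedAge
  rw [← NNReal.coe_lt_coe, Real.coe_toNNReal', max_lt_iff]
  refine ⟨?_, by exact_mod_cast hb⟩
  have hbdd : BddAbove (insert (-(a n : ℝ))
      {s | ∃ i, σ.serviceStart n i ≤ t ∧ s = (T.gen n i : ℝ)}) := by
    refine ⟨t, ?_⟩
    rintro s (rfl | ⟨i, hi, rfl⟩)
    · exact (neg_nonpos.2 (a n).2).trans t.2
    · have h1 : (T.arr n i : ℝ≥0∞) ≤ σ.serviceStart n i :=
        le_iInf₂ fun k hk => by
          have := hσ.arr_le_start k
          rwa [hk.1, hk.2] at this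
      exact_mod_cast (T.gen_le_arr n i).trans (by exact_mod_cast h1.trans hi)
  rcases hn with hn | ⟨k, hk, rfl, hc⟩
  · have := le_csSup hbdd (Or.inl rfl : -(a n : ℝ) ∈ _)
    linarith
  · have h1 : σ.serviceStart (σ.flow k) (σ.pkt k) ≤ t :=
      (iInf₂_le (f := fun k' (_ : σ.flow k' = σ.flow k ∧ σ.pkt k' = σ.pkt k) => σ.start k')
        k ⟨rfl, rfl⟩).trans hk
    have := le_csSup hbdd (Or.inr ⟨_, h1, rfl⟩ : (T.gen (σ.flow k) (σ.pkt k) : ℝ) ∈ _)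
    linarith

theorem mem_freshFlows_of_age_lt (hσ : σ.Feasible T x) {t b : ℝ≥0} {n : Fin N}
    (hn : σ.age T a x t n < b) : n ∈ σ.freshFlows T a (σ.finish x) t (t - b) := by
  unfold age at hn
  rw [← NNReal.coe_lt_coe, Real.coe_toNNReal', max_lt_iff] at hn
  obtain ⟨s, hs, hlt⟩ := exists_lt_of_lt_csSup (Set.insert_nonempty _ _)
    (show (t : ℝ) - b < _ by linarith [hn.1])
  rcases hs with rfl | ⟨i, hi, rfl⟩
  · exact Or.inl hlt
  · -- at most one of the starts of this packet is finite, so the infimum is attained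
    have hlt1 : σ.delivery x n i < ⊤ := hi.trans_lt ENNReal.coe_lt_top
    simp only [delivery, iInf_lt_iff] at hlt1
    obtain ⟨k, hk, hkt⟩ := hlt1
    have hle : σ.finish x k ≤ σ.delivery x n i := by
      refine le_iInf₂ fun k' hk' => ?_
      have hktop : σ.start k ≠ ⊤ := fun h => by simp [finish, h] at hkt
      rcases lt_trichotomy k k' with h | rfl | h
      · have : σ.start k' = ⊤ := by
          by_contra htop
          exact hσ.served_once k k' h htop ⟨hk.1.trans hk'.1.symm, hk.2.trans hk'.2.symm⟩
        simp [finish, this]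
      · exact le_rfl
      · exact absurd ⟨hk'.1.trans hk.1.symm, hk'.2.trans hk.2.symm⟩
          (hσ.served_once k' k h hktop)
    exact Or.inr ⟨k, hle.trans hi, hk.1, by rwa [hk.2]⟩

/-- Sample-path comparison: if no service of `σ'` that begins during a service of the
work-conserving schedule `σ` on the same server is completed before that service, then every
symmetric non-decreasing penalty of the Age of Served Information under `σ` is at most that of the age
under `σ'`. -/
theorem penalty_servedAge_le_age (hT : T.Synchronized) (hσ : σ.Feasible T x)
    (hwc : σ.WorkConserving T x) (hsel : σ.SelectsMASIFLGFS T a) (hσ' : σ'.Feasible T x')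
    (hdom : ∀ k q, σ'.start k ≠ ⊤ → σ.InService x (σ'.server k) (σ'.start k) q →
      σ.finish x q ≤ σ'.finish x' k) {p : (Fin N → ℝ≥0) → ℝ} (hp : IsSymmPenalty p) (t : ℝ≥0) :
    p (σ.servedAge T a t) ≤ p (σ'.age T a x' t) := by
  refine hp.le_of_card_lt fun b => ?_
  rcases eq_or_ne b 0 with rfl | hb
  · simp
  have h := ncard_freshFlows_le hT hσ hwc hsel hσ' hdom t ((t : ℝ) - b)
  simp only [← Set.ncard_coe_finset]
  refine (Set.ncard_le_ncard ?_ (Set.toFinite _)).trans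
    (h.trans (Set.ncard_le_ncard ?_ (Set.toFinite _)))
  · intro n hn
    exact mem_freshFlows_of_age_lt hσ' (by simpa using hn)
  · intro n hn
    simpa using servedAge_lt_of_mem_freshFlows hσ (pos_iff_ne_zero.2 hb) hn

end Schedule

/-! ### Coupling a residual service time with a fresh one -/

/-- Generalized inverse of the tail `y ↦ m (y, ∞)` of a measure on `[0, ∞)`. It is `⊤` at levels
that the tail never goes below. -/
def tailInv (m : Measure ℝ≥0) (c : ℝ≥0∞) : ℝ≥0∞ :=
  ⨅ (z : ℝ≥0) (_ : m (Set.Ioi z) < c), (z : ℝ≥0∞)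

theorem measurable_tailInv (m : Measure ℝ≥0) : Measurable (tailInv m) := by
  refine Antitone.measurable fun c c' h => ?_
  exact le_iInf₂ fun z hz => iInf₂_le z (hz.trans_le h)

theorem tailInv_le {m : Measure ℝ≥0} {c : ℝ≥0∞} {z : ℝ≥0} (h : m (Set.Ioi z) < c) :
    tailInv m c ≤ z :=
  iInf₂_le z h

theorem lt_tailInv {m : Measure ℝ≥0} {c : ℝ≥0∞} {y : ℝ≥0} (h : c < m (Set.Ioi y)) :
    (y : ℝ≥0∞) < tailInv m c := by
  obtain ⟨u, hu, huy, hut⟩ := exists_seq_strictAnti_tendsto y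
  have hU : Set.Ioi y = ⋃ n, Set.Ioi (u n) := by
    ext z
    simp only [Set.mem_Ioi, Set.mem_iUnion]
    exact ⟨fun hz => ((hut.eventually (gt_mem_nhds hz)).exists),
      fun ⟨n, hn⟩ => (huy n).trans hn⟩
  have hmono : Monotone fun n => Set.Ioi (u n) := fun n n' h => Set.Ioi_subset_Ioi (hu.antitone h)
  rw [hU, hmono.measure_iUnion, lt_iSup_iff] at h
  obtain ⟨n, hn⟩ := h
  refine (ENNReal.coe_lt_coe.2 (huy n)).trans_le (le_iInf₂ fun z hz => ?_)
  by_contra! hlt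
  exact absurd (hz.trans hn)
    (not_lt.2 (measure_mono (Set.Ioi_subset_Ioi (ENNReal.coe_lt_coe.1 hlt).le)))

theorem tailInv_ne_top {m : Measure ℝ≥0} [IsFiniteMeasure m] {c : ℝ≥0∞} (hc : 0 < c) :
    tailInv m c ≠ ⊤ := by
  have h1 : Filter.Tendsto (fun n : ℕ => m (Set.Ioi (n : ℝ≥0))) Filter.atTop
      (nhds (m (⋂ n : ℕ, Set.Ioi (n : ℝ≥0)))) :=
    tendsto_measure_iInter_atTop (fun n => measurableSet_Ioi.nullMeasurableSet)
      (fun n n' h => Set.Ioi_subset_Ioi (by exact_mod_cast h)) ⟨0, measure_ne_top _ _⟩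
  have h2 : (⋂ n : ℕ, Set.Ioi (n : ℝ≥0)) = ∅ := by
    ext z
    simp only [Set.mem_iInter, Set.mem_Ioi, Set.mem_empty_iff_false, iff_false, not_forall, not_lt]
    exact exists_nat_ge z
  rw [h2, measure_empty] at h1
  obtain ⟨n, hn⟩ := (h1.eventually (gt_mem_nhds hc)).exists
  exact ne_top_of_le_ne_top ENNReal.coe_ne_top (tailInv_le hn)

/-- A point `u` of the unit interval as an extended non-negative real. -/
def unitENN (u : unitInterval) : ℝ≥0∞ := ENNReal.ofReal u

theorem measurable_unitENN : Measurable unitENN :=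
  ENNReal.measurable_ofReal.comp measurable_subtype_coe

/-- Inverse transform sampling. -/
theorem map_tailInv (m : Measure ℝ≥0) [IsFiniteMeasure m] (hm : m Set.univ ≠ 0) :
    (volume : Measure unitInterval).map (fun u => (tailInv m (unitENN u * m Set.univ)).toNNReal) =
      (m Set.univ)⁻¹ • m := by
  have hmeas : Measurable fun u : unitInterval =>
      (tailInv m (unitENN u * m Set.univ)).toNNReal :=
    ((measurable_tailInv m).comp (measurable_unitENN.mul_const _)).ennreal_toNNReal
  have hT : m Set.univ ≠ ⊤ := measure_ne_top _ _
  have hprob : IsProbabilityMeasure ((m Set.univ)⁻¹ • m) :=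
    ⟨by simp [ENNReal.inv_mul_cancel hm hT]⟩
  have := Measure.isProbabilityMeasure_map (μ := (volume : Measure unitInterval)) hmeas.aemeasurable
  have hIoi : ∀ y, (volume : Measure unitInterval).map
      (fun u => (tailInv m (unitENN u * m Set.univ)).toNNReal) (Set.Ioi y) =
      ((m Set.univ)⁻¹ • m) (Set.Ioi y) := by
    intro y
    rw [Measure.map_apply hmeas measurableSet_Ioi]
    set θ : ℝ := (((m Set.univ)⁻¹ • m) (Set.Ioi y)).toReal with hθ
    have hθ' : ENNReal.ofReal θ = ((m Set.univ)⁻¹ • m) (Set.Ioi y) :=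
      ENNReal.ofReal_toReal (measure_ne_top _ _)
    have hθI : θ ∈ unitInterval := ⟨ENNReal.toReal_nonneg, by
      rw [← ENNReal.ofReal_le_one, hθ']; exact prob_le_one⟩
    have hθT : ENNReal.ofReal θ * m Set.univ = m (Set.Ioi y) := by
      rw [hθ', Measure.smul_apply, smul_eq_mul, mul_comm, ← mul_assoc,
        ENNReal.mul_inv_cancel hm hT, one_mul]
    rw [← hθ']
    refine le_antisymm ?_ ?_
    · calc _ ≤ (volume : Measure unitInterval) (Set.Iic ⟨θ, hθI⟩) := measure_mono ?_
        _ = _ := by simp [unitInterval.volume_Iic]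
      intro u hu
      rw [Set.mem_Iic, ← Subtype.coe_le_coe]
      by_contra! hlt
      have h1 : m (Set.Ioi y) < unitENN u * m Set.univ := by
        rw [← hθT]
        refine ENNReal.mul_lt_mul_left hm hT ?_
        exact (ENNReal.ofReal_lt_ofReal_iff (hθI.1.trans_lt hlt)).2 hlt
      have h2 := ENNReal.toNNReal_mono ENNReal.coe_ne_top (tailInv_le h1)
      exact absurd h2 (not_le.2 (by simpa using hu))
    · calc _ = (volume : Measure unitInterval) (Set.Ioo 0 ⟨θ, hθI⟩) := by
            simp [unitInterval.volume_Ioo]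
        _ ≤ _ := measure_mono ?_
      rintro u ⟨hu0, hu⟩
      have hu0' : (0 : ℝ) < u := hu0
      have hu' : (u : ℝ) < θ := hu
      have h1 : unitENN u * m Set.univ < m (Set.Ioi y) := by
        rw [← hθT]
        refine ENNReal.mul_lt_mul_left hm hT ?_
        exact (ENNReal.ofReal_lt_ofReal_iff (hu0'.trans hu')).2 hu'
      have hpos : 0 < unitENN u * m Set.univ :=
        ENNReal.mul_pos (ENNReal.ofReal_pos.2 hu0').ne' hm
      have h2 := lt_tailInv h1
      rw [← ENNReal.coe_toNNReal (tailInv_ne_top hpos)] at h2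
      exact ENNReal.coe_lt_coe.1 h2
  refine Measure.ext_of_Iic _ _ fun y => ?_
  rw [← compl_compl (Set.Iic y), Set.compl_Iic, prob_compl_eq_one_sub measurableSet_Ioi,
    prob_compl_eq_one_sub measurableSet_Ioi, hIoi]

theorem tailInv_restrict_Ioi {μ : Measure ℝ≥0} {s : ℝ≥0} {c : ℝ≥0∞} (hc : c ≤ μ (Set.Ioi s)) :
    tailInv (μ.restrict (Set.Ioi s)) c = tailInv μ c := by
  unfold tailInv
  refine iInf_congr fun z => iInf_congr_Prop ?_ fun _ => rfl
  rw [Measure.restrict_apply measurableSet_Ioi, Set.Ioi_inter_Ioi]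
  rcases le_total z s with h | h
  · rw [sup_eq_right.2 h]
    exact ⟨fun h1 => absurd hc (not_le.2 h1), fun h1 => absurd
      (hc.trans (measure_mono (Set.Ioi_subset_Ioi h))) (not_le.2 h1)⟩
  · rw [sup_eq_left.2 h]

/-- The NBU property in terms of tail inverses: a service time conditioned to exceed `s` is at most
`s` plus a fresh service time, if both are sampled from the same uniform variable. -/
theorem IsNBU.tailInv_le {μ : Measure ℝ≥0} [IsFiniteMeasure μ] (hμ : IsNBU μ) {s : ℝ≥0}
    (hs : μ (Set.Ioi s) ≠ 0) (c : ℝ≥0∞) :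
    tailInv μ (c * μ (Set.Ioi s)) ≤ s + tailInv μ c := by
  unfold tailInv
  simp only [ENNReal.add_iInf]
  refine le_iInf₂ fun z hz => ?_
  rw [← ENNReal.coe_add]
  refine StatusUpdate.tailInv_le ((hμ s z).trans_lt ?_)
  rw [mul_comm]
  exact ENNReal.mul_lt_mul_left hs (measure_ne_top _ _) hz

/-- The map `V` turns a total service time `v` of which `s < v` has elapsed into a service time
`V s v w` that is at least the residual service time `v - s`, with the help of a uniform variable
`w`; and if `X` has law `μ` and `w` is independent of `X`, then conditionally on `X > s` the
variable `V s X w` has law `μ` again. -/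
structure IsResidualCoupling (μ : Measure ℝ≥0) (V : ℝ≥0 → ℝ≥0 → unitInterval → ℝ≥0) : Prop where
  measurable : Measurable fun q : (ℝ≥0 × ℝ≥0) × unitInterval => V q.1.1 q.1.2 q.2
  le_add : ∀ s v w, v ≤ s + V s v w
  law : ∀ (s : ℝ≥0) (g : ℝ≥0 → ℝ≥0∞), Measurable g →
    ∫⁻ v in Set.Ioi s, (∫⁻ w, g (V s v w)) ∂μ = ∫⁻ _ in Set.Ioi s, (∫⁻ u, g u ∂μ) ∂μ

/-- The residual life of an NBU service time is stochastically smaller than a fresh one, and hence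
can be coupled with it. The map `V` represents the conditional law of `tailInv μ u` given
`tailInv μ (u * μ (s, ∞)) = v`, where `u` is uniform. -/
theorem IsNBU.exists_residual_coupling {μ : Measure ℝ≥0} [IsProbabilityMeasure μ] (hμ : IsNBU μ) :
    ∃ V : ℝ≥0 → ℝ≥0 → unitInterval → ℝ≥0, IsResidualCoupling μ V := by
  have htail : Measurable fun s : ℝ≥0 => μ (Set.Ioi s) :=
    Antitone.measurable fun s s' h => measure_mono (Set.Ioi_subset_Ioi h)
  let f : ℝ≥0 × unitInterval → ℝ≥0 × ℝ≥0 := fun q =>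
    ((tailInv μ (unitENN q.2 * μ (Set.Ioi q.1))).toNNReal, (tailInv μ (unitENN q.2)).toNNReal)
  have hf : Measurable f :=
    ((measurable_tailInv μ).comp ((measurable_unitENN.comp measurable_snd).mul
      (htail.comp measurable_fst))).ennreal_toNNReal.prodMk
      ((measurable_tailInv μ).comp (measurable_unitENN.comp measurable_snd)).ennreal_toNNReal
  let κ : ProbabilityTheory.Kernel ℝ≥0 (ℝ≥0 × ℝ≥0) :=
    (ProbabilityTheory.Kernel.prod (ProbabilityTheory.Kernel.deterministic id measurable_id)
      (ProbabilityTheory.Kernel.const ℝ≥0 (volume : Measure unitInterval))).map f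
  have hκm : ProbabilityTheory.IsMarkovKernel κ := ProbabilityTheory.Kernel.IsMarkovKernel.map _ hf
  have hκ : ∀ s, κ s = (volume : Measure unitInterval).map fun u => f (s, u) := by
    intro s
    rw [ProbabilityTheory.Kernel.map_apply _ hf, ProbabilityTheory.Kernel.prod_apply,
      ProbabilityTheory.Kernel.deterministic_apply, ProbabilityTheory.Kernel.const_apply,
      Measure.dirac_prod, Measure.map_map hf measurable_prodMk_left]
    rfl
  obtain ⟨V, hV, hVlaw⟩ :=
    ProbabilityTheory.Kernel.exists_measurable_map_eq_unitInterval κ.condKernel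
  refine ⟨fun s v w => max (V (s, v) w) (v - s), ?_, fun s v w => ?_, fun s g hg => ?_⟩
  · exact (hV.comp (measurable_fst.prodMk measurable_snd)).max
      ((measurable_snd.comp measurable_fst).sub (measurable_fst.comp measurable_fst))
  · exact tsub_le_iff_left.1 (le_max_right _ _)
  rcases eq_or_ne (μ (Set.Ioi s)) 0 with hs | hs
  · rw [Measure.restrict_eq_zero.2 hs]; simp
  have hfs : Measurable fun u => f (s, u) := hf.comp measurable_prodMk_left
  have hG : Measurable fun q : ℝ≥0 × ℝ≥0 => g (max q.2 (q.1 - s)) :=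
    hg.comp (measurable_snd.max (measurable_fst.sub_const _))
  -- the first marginal is the conditional law of the total service time
  have hfst : κ.fst s = (μ (Set.Ioi s))⁻¹ • μ.restrict (Set.Ioi s) := by
    have h1 := map_tailInv (μ.restrict (Set.Ioi s)) (by simpa using hs)
    rw [Measure.restrict_apply_univ] at h1
    rw [← h1, ProbabilityTheory.Kernel.fst_apply, hκ, Measure.map_map measurable_fst hfs]
    congr 1
    funext u
    rw [tailInv_restrict_Ioi]
    · rfl
    · exact mul_le_of_le_one_left zero_le (ENNReal.ofReal_le_one.2 u.2.2)
  have hsnd : (volume : Measure unitInterval).map (fun u => (tailInv μ (unitENN u)).toNNReal) =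
      μ := by
    have h1 := map_tailInv μ (by simp)
    simpa using h1
  have h2 : ∫⁻ v, (∫⁻ w, g (max (V (s, v) w) (v - s))) ∂(κ.fst s) = ∫⁻ u, g u ∂μ := by
    calc _ = ∫⁻ v, ∫⁻ u, g (max u (v - s)) ∂(κ.condKernel (s, v)) ∂(κ.fst s) := by
          refine lintegral_congr fun v => ?_
          have hg' : Measurable fun u => g (max u (v - s)) :=
            hg.comp (measurable_id.max measurable_const)
          rw [← hVlaw, lintegral_map hg' hV.of_uncurry_left]
      _ = ∫⁻ q, g (max q.2 (q.1 - s)) ∂(κ s) := by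
          conv_rhs => rw [← κ.disintegrate κ.condKernel]
          rw [ProbabilityTheory.Kernel.lintegral_compProd _ _ _ hG]
      _ = ∫⁻ u, g (tailInv μ (unitENN u)).toNNReal := by
          rw [hκ, lintegral_map hG hfs]
          have hne : ∀ᵐ u : unitInterval, u ≠ 0 := by simp [ae_iff]
          refine lintegral_congr_ae ?_
          filter_upwards [hne] with u hu
          congr 1
          refine max_eq_left (tsub_le_iff_left.2 ?_)
          have hu0 : 0 < unitENN u := ENNReal.ofReal_pos.2
            (lt_of_le_of_ne u.2.1 fun h => hu (Subtype.ext h.symm))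
          have h3 := ENNReal.toNNReal_mono (by simp [tailInv_ne_top hu0])
            (hμ.tailInv_le hs (unitENN u))
          rwa [ENNReal.toNNReal_add ENNReal.coe_ne_top (tailInv_ne_top hu0),
            ENNReal.toNNReal_coe] at h3
      _ = _ := by
          conv_rhs => rw [← hsnd]
          have hm : Measurable fun u => (tailInv μ (unitENN u)).toNNReal :=
            ((measurable_tailInv μ).comp measurable_unitENN).ennreal_toNNReal
          rw [lintegral_map hg hm]
  rw [lintegral_const, Measure.restrict_apply_univ, ← h2, hfst, lintegral_smul_measure,
    smul_eq_mul, mul_right_comm, ENNReal.inv_mul_cancel hs (measure_ne_top _ _), one_mul]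

/-! ### Resampling coordinates of i.i.d. families -/

theorem lintegral_eq_tsum_fiber {ι β : Type*} [Countable ι] [MeasurableSpace ι]
    [MeasurableSingletonClass ι] [MeasurableSpace β] (m : Measure β) {s : β → ι}
    (hs : Measurable s) (F : β → ℝ≥0∞) :
    ∫⁻ x, F x ∂m = ∑' c, ∫⁻ x in s ⁻¹' {c}, F x ∂m := by
  rw [← lintegral_iUnion (fun c => hs (measurableSet_singleton c))]
  · rw [← Set.preimage_iUnion, Set.iUnion_of_singleton, Set.preimage_univ, setLIntegral_univ]
  · intro c c' hcc
    exact Disjoint.preimage _ (Set.disjoint_singleton.2 hcc)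

section Resampling

variable {ι α : Type*} [DecidableEq ι] [MeasurableSpace α]
  (μ : Measure α) [IsProbabilityMeasure μ]

theorem measurePreserving_update (c : ι) :
    MeasurePreserving (fun q : (ι → α) × α => Function.update q.1 c q.2)
      ((Measure.infinitePi fun _ : ι => μ).prod μ) (Measure.infinitePi fun _ : ι => μ) := by
  have hmeas : Measurable fun q : (ι → α) × α => Function.update q.1 c q.2 := measurable_update'
  refine ⟨hmeas, Measure.eq_infinitePi _ fun J t ht => ?_⟩
  rw [Measure.map_apply hmeas (MeasurableSet.pi J.countable_toSet fun i _ => ht i)]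
  by_cases hc : c ∈ J
  · have : (fun q : (ι → α) × α => Function.update q.1 c q.2) ⁻¹' (Set.pi J t) =
        (Set.pi (J.erase c : Finset ι) t) ×ˢ t c := by
      ext ⟨x, v⟩
      simp only [Set.mem_preimage, Set.mem_pi, Finset.mem_coe, Set.mem_prod, Finset.mem_erase]
      constructor
      · intro h
        refine ⟨fun i hi => ?_, by simpa using h c hc⟩
        simpa [Function.update_of_ne hi.1] using h i hi.2
      · rintro ⟨h1, h2⟩ i hi
        rcases eq_or_ne i c with rfl | hic
        · simpa using h2
        · simpa [Function.update_of_ne hic] using h1 i ⟨hic, hi⟩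
    rw [this, Measure.prod_prod, Measure.infinitePi_pi _ (fun i _ => ht i),
      Finset.prod_erase_mul _ _ hc]
  · have : (fun q : (ι → α) × α => Function.update q.1 c q.2) ⁻¹' (Set.pi J t) =
        (Set.pi J t) ×ˢ Set.univ := by
      ext ⟨x, v⟩
      simp only [Set.mem_preimage, Set.mem_pi, Finset.mem_coe, Set.mem_prod, Set.mem_univ,
        and_true]
      refine forall₂_congr fun i hi => ?_
      rw [Function.update_of_ne (by rintro rfl; exact hc hi)]
    rw [this, Measure.prod_prod, Measure.infinitePi_pi _ (fun i _ => ht i), measure_univ, mul_one]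

theorem lintegral_infinitePi_update (c : ι) {F : (ι → α) → ℝ≥0∞} (hF : Measurable F) :
    ∫⁻ x, (∫⁻ v, F (Function.update x c v) ∂μ) ∂(Measure.infinitePi fun _ : ι => μ) =
      ∫⁻ x, F x ∂(Measure.infinitePi fun _ : ι => μ) := by
  rw [← (measurePreserving_update μ c).lintegral_comp hF, lintegral_prod]
  exact (hF.comp measurable_update').aemeasurable

/-- Resampling a coordinate of an i.i.d. family does not change its law, even if the coordinate is
chosen at random, as long as this choice does not look at the chosen coordinate. -/
theorem lintegral_infinitePi_update_random [Countable ι] [MeasurableSpace ι]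
    [MeasurableSingletonClass ι] {s : (ι → α) → ι} (hs : Measurable s)
    (hsu : ∀ x v, s (Function.update x (s x) v) = s x) {F : (ι → α) → ℝ≥0∞} (hF : Measurable F) :
    ∫⁻ x, (∫⁻ v, F (Function.update x (s x) v) ∂μ) ∂(Measure.infinitePi fun _ : ι => μ) =
      ∫⁻ x, F x ∂(Measure.infinitePi fun _ : ι => μ) := by
  rw [lintegral_eq_tsum_fiber _ hs, lintegral_eq_tsum_fiber _ hs F]
  refine tsum_congr fun c => ?_
  have hsc : MeasurableSet (s ⁻¹' {c}) := hs (measurableSet_singleton c)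
  rw [← lintegral_indicator hsc, ← lintegral_indicator hsc,
    ← lintegral_infinitePi_update μ c (hF.indicator hsc)]
  refine lintegral_congr fun x => ?_
  have hiff : ∀ v, Function.update x c v ∈ s ⁻¹' {c} ↔ x ∈ s ⁻¹' {c} := by
    intro v
    simp only [Set.mem_preimage, Set.mem_singleton_iff]
    constructor
    · intro h
      have := hsu (Function.update x c v) (x c)
      rwa [h, Function.update_idem, Function.update_eq_self] at this
    · intro h
      have := hsu x v
      rwa [h] at this
  by_cases hx : x ∈ s ⁻¹' {c}
  · rw [Set.indicator_of_mem hx]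
    refine lintegral_congr fun v => ?_
    rw [Set.indicator_of_mem ((hiff v).2 hx), show s x = c from hx]
  · rw [Set.indicator_of_notMem hx]
    simp only [Set.indicator_of_notMem (fun h => hx ((hiff _).1 h)), lintegral_zero]

end Resampling

/-! ### Causality -/

variable {N M : ℕ} {T : Traffic N} {R : Type*} [MeasurableSpace R]

namespace Schedule

theorem slot_injective (σ : Schedule N M) : Function.Injective σ.slot := by
  intro j k h
  wlog hlt : j < k generalizing j k
  · rcases lt_trichotomy j k with h1 | h1 | h1
    · exact this h h1
    · exact h1
    · exact (this h.symm h1).symm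
  simp only [slot, Prod.mk.injEq] at h
  refine absurd h.2 (Finset.card_lt_card ?_).ne
  refine (Finset.ssubset_iff_of_subset fun i hi => ?_).2 ⟨j, ?_, ?_⟩
  · simp only [Finset.mem_filter, Finset.mem_range] at hi ⊢
    exact ⟨hi.1.trans hlt, hi.2.trans h.1⟩
  · simpa using ⟨hlt, h.1⟩
  · simp

theorem slot_congr {σ σ' : Schedule N M} {k : ℕ} (h : ∀ j ≤ k, σ'.server j = σ.server j) :
    σ'.slot k = σ.slot k := by
  unfold slot
  rw [h k le_rfl]
  congr 2
  refine Finset.filter_congr fun j hj => ?_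
  rw [h j (Finset.mem_range.1 hj).le]

/-- Two schedules have the same starts, on the same servers and using the same service times, up
to number `k`. -/
def AgreeTo (σ σ' : Schedule N M) (k : ℕ) : Prop :=
  ∀ j ≤ k, σ'.start j = σ.start j ∧ σ'.server j = σ.server j ∧ σ'.slot j = σ.slot j

theorem AgreeTo.trans {σ σ' σ'' : Schedule N M} {k : ℕ} (h : σ.AgreeTo σ' k)
    (h' : σ'.AgreeTo σ'' k) : σ.AgreeTo σ'' k := fun j hj =>
  ⟨(h' j hj).1.trans (h j hj).1, (h' j hj).2.1.trans (h j hj).2.1,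
    (h' j hj).2.2.trans (h j hj).2.2⟩

end Schedule

theorem Policy.feasible_mk (π : Policy T M R) (r : R) (x : ServiceTimes M) :
    (π.run (r, x)).Feasible T x :=
  π.feasible (r, x)

/-- Causality for the first `k + 1` starts together: they are not affected by changing service times
that are not used before start `k`, or that stay in progress at start `k`. -/
theorem Policy.agreeTo_of_observed (π : Policy T M R) {r : R} {x x' : ServiceTimes M} {k : ℕ}
    (h : ∀ j < k, x ((π.run (r, x)).slot j) = x' ((π.run (r, x)).slot j) ∨
      ((π.run (r, x)).start k < (π.run (r, x)).start j + (x ((π.run (r, x)).slot j) : ℝ≥0∞) ∧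
        (π.run (r, x)).start k <
          (π.run (r, x)).start j + (x' ((π.run (r, x)).slot j) : ℝ≥0∞))) :
    (π.run (r, x)).AgreeTo (π.run (r, x')) k := by
  have key : ∀ j ≤ k, (π.run (r, x')).start j = (π.run (r, x)).start j ∧
      (π.run (r, x')).server j = (π.run (r, x)).server j := by
    intro j hj
    have := π.causal r x x' j fun i hi => (h i (hi.trans_le hj)).imp_right fun h' =>
      have hjk := (π.feasible_mk r x).start_mono hj
      ⟨hjk.trans_lt h'.1, hjk.trans_lt h'.2⟩
    exact ⟨this.1, this.2.1⟩
  exact fun j hj => ⟨(key j hj).1, (key j hj).2,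
    Schedule.slot_congr fun i hi => (key i (hi.trans hj)).2⟩

theorem Policy.agreeTo_of_eq (π : Policy T M R) {r : R} {x x' : ServiceTimes M} {k : ℕ}
    (h : ∀ j < k, x ((π.run (r, x)).slot j) = x' ((π.run (r, x)).slot j)) :
    (π.run (r, x)).AgreeTo (π.run (r, x')) k :=
  π.agreeTo_of_observed fun j hj => Or.inl (h j hj)

theorem Policy.agreeTo_update_slot (π : Policy T M R) (r : R) (x : ServiceTimes M) (k : ℕ)
    (v : ℝ≥0) : (π.run (r, x)).AgreeTo
      (π.run (r, Function.update x ((π.run (r, x)).slot k) v)) k :=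
  π.agreeTo_of_eq fun _ hj =>
    (Function.update_of_ne (fun h => hj.ne ((π.run (r, x)).slot_injective h)) _ _).symm

/-! ### The coupled service times -/

open Classical in
/-- The duration given to a service that the second system starts at time `τ` on server `m`, when
the first system follows the schedule `σ` with service times `x`. If that server is in service in
the first system, the duration is obtained from the service time in progress by the map `V`, with
the uniform variable `w.1`; otherwise it is the fresh service time `w.2`. -/
def coupledTime (V : ℝ≥0 → ℝ≥0 → unitInterval → ℝ≥0) (σ : Schedule N M) (x : ServiceTimes M)
    (m : Fin M) (τ : ℝ≥0∞) (w : unitInterval × ℝ≥0) : ℝ≥0 :=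
  if h : ∃ q, σ.InService x m τ q then
    V (τ - σ.start (Nat.find h)).toNNReal (x (σ.slot (Nat.find h))) w.1
  else w.2

section CoupledTime

variable {V : ℝ≥0 → ℝ≥0 → unitInterval → ℝ≥0} {σ : Schedule N M} {x : ServiceTimes M}
  {m : Fin M} {τ : ℝ≥0∞} {w : unitInterval × ℝ≥0}

theorem coupledTime_of_inService (hσ : σ.Feasible T x) {q : ℕ} (hq : σ.InService x m τ q) :
    coupledTime V σ x m τ w = V (τ - σ.start q).toNNReal (x (σ.slot q)) w.1 := by
  classical
  have h : ∃ q, σ.InService x m τ q := ⟨q, hq⟩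
  rw [coupledTime, dif_pos h, Schedule.InService.unique hσ (Nat.find_spec h) hq]

theorem coupledTime_of_not_inService (h : ¬ ∃ q, σ.InService x m τ q) :
    coupledTime V σ x m τ w = w.2 := by
  rw [coupledTime, dif_neg h]

theorem finish_le_add_coupledTime (hV : ∀ s v w, v ≤ s + V s v w) (hσ : σ.Feasible T x) {q : ℕ}
    (hq : σ.InService x m τ q) : σ.finish x q ≤ τ + (coupledTime V σ x m τ w : ℝ≥0∞) := by
  rw [coupledTime_of_inService hσ hq]
  have hτ : τ ≠ ⊤ := (hq.2.2.trans_le le_top).ne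
  have h1 : σ.start q + ((τ - σ.start q).toNNReal : ℝ≥0∞) = τ := by
    rw [ENNReal.coe_toNNReal (ne_top_of_le_ne_top hτ tsub_le_self)]
    exact add_tsub_cancel_of_le hq.2.1
  conv_rhs => rw [← h1]
  rw [add_assoc, Schedule.finish]
  gcongr
  rw [← ENNReal.coe_add, h1]
  exact_mod_cast hV _ _ _

end CoupledTime

/-- The randomness used for the coupling: provisional service times for the second system, and a
uniform variable and a fresh service time for each of its service starts. -/
abbrev CouplingSeed (M : ℕ) := ServiceTimes M × (ℕ → unitInterval × ℝ≥0)

section Coupling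

variable (P π : Policy T M R) (V : ℝ≥0 → ℝ≥0 → unitInterval → ℝ≥0) (r : R) (x : ServiceTimes M)
  (η : CouplingSeed M)

/-- The service times of the second system (with policy `π`) after the durations of its first `k`
services have been determined. The first `k + 1` starts of `π` are known then, and the duration of
the service that begins with start `k` is determined next. -/
def coupledIter : ℕ → ServiceTimes M
  | 0 => η.1
  | k + 1 => Function.update (coupledIter k) ((π.run (r, coupledIter k)).slot k)
      (coupledTime V (P.run (r, x)) x ((π.run (r, coupledIter k)).server k)
        ((π.run (r, coupledIter k)).start k) (η.2 k))

theorem agreeTo_coupledIter {k m : ℕ} (hkm : k ≤ m) :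
    (π.run (r, coupledIter P π V r x η k)).AgreeTo (π.run (r, coupledIter P π V r x η m)) k := by
  induction m, hkm using Nat.le_induction with
  | base => exact fun j _ => ⟨rfl, rfl, rfl⟩
  | succ m hkm ih =>
    exact ih.trans fun j hj => π.agreeTo_update_slot r _ m _ j (hj.trans hkm)

theorem coupledIter_slot {k m : ℕ} (hkm : k < m) :
    coupledIter P π V r x η m ((π.run (r, coupledIter P π V r x η k)).slot k) =
      coupledTime V (P.run (r, x)) x ((π.run (r, coupledIter P π V r x η k)).server k)
        ((π.run (r, coupledIter P π V r x η k)).start k) (η.2 k) := by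
  induction m, (hkm : k + 1 ≤ m) using Nat.le_induction with
  | base => exact Function.update_self _ _ _
  | succ m hkm' ih =>
    rw [← ih, coupledIter, Function.update_of_ne]
    rw [← (agreeTo_coupledIter P π V r x η (Nat.le_of_succ_le hkm') k le_rfl).2.2]
    exact fun h => (Nat.lt_of_succ_le hkm').ne (Schedule.slot_injective _ h)

theorem exists_forall_coupledIter_eq (s : Fin M × ℕ) :
    ∃ K, ∀ k ≥ K, coupledIter P π V r x η k s = coupledIter P π V r x η K s := by
  by_cases h : ∃ j, (π.run (r, coupledIter P π V r x η j)).slot j = s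
  · obtain ⟨j, rfl⟩ := h
    exact ⟨j + 1, fun k hk => by
      rw [coupledIter_slot P π V r x η hk, coupledIter_slot P π V r x η (Nat.lt_succ_self j)]⟩
  · push Not at h
    refine ⟨0, fun k _ => ?_⟩
    induction k with
    | zero => rfl
    | succ k ih => rw [← ih (Nat.zero_le _), coupledIter, Function.update_of_ne (h k).symm]

/-- The service times of the second system: the eventual values of `coupledIter`. -/
def coupledTimes : ServiceTimes M := fun s =>
  coupledIter P π V r x η (exists_forall_coupledIter_eq P π V r x η s).choose s

theorem eventually_coupledIter_eq (s : Fin M × ℕ) :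
    ∀ᶠ k in Filter.atTop, coupledIter P π V r x η k s = coupledTimes P π V r x η s :=
  Filter.eventually_atTop.2 ⟨_, (exists_forall_coupledIter_eq P π V r x η s).choose_spec⟩

theorem coupledTimes_slot (k : ℕ) :
    coupledTimes P π V r x η ((π.run (r, coupledIter P π V r x η k)).slot k) =
      coupledTime V (P.run (r, x)) x ((π.run (r, coupledIter P π V r x η k)).server k)
        ((π.run (r, coupledIter P π V r x η k)).start k) (η.2 k) := by
  obtain ⟨m, hm, hkm⟩ := ((eventually_coupledIter_eq P π V r x η
    ((π.run (r, coupledIter P π V r x η k)).slot k)).and (Filter.eventually_gt_atTop k)).exists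
  rw [← hm, coupledIter_slot P π V r x η hkm]

theorem agreeTo_coupledTimes (k : ℕ) :
    (π.run (r, coupledIter P π V r x η k)).AgreeTo (π.run (r, coupledTimes P π V r x η)) k := by
  refine π.agreeTo_of_eq fun j hj => ?_
  rw [(agreeTo_coupledIter P π V r x η hj.le j le_rfl).2.2, coupledTimes_slot,
    coupledIter_slot P π V r x η hj]

/-- A service of `π` in the second system that begins during a service of `P` on the same server
in the first system does not end before that service. -/
theorem finish_le_finish_coupledTimes (hV : ∀ s v w, v ≤ s + V s v w) (k q : ℕ)
    (hq : (P.run (r, x)).InService x ((π.run (r, coupledTimes P π V r x η)).server k)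
      ((π.run (r, coupledTimes P π V r x η)).start k) q) :
    (P.run (r, x)).finish x q ≤
      (π.run (r, coupledTimes P π V r x η)).finish (coupledTimes P π V r x η) k := by
  obtain ⟨h1, h2, h3⟩ := agreeTo_coupledTimes P π V r x η k k le_rfl
  rw [h1, h2] at hq
  rw [Schedule.finish.eq_1 (π.run _), h1, h3, coupledTimes_slot]
  exact finish_le_add_coupledTime hV (P.feasible_mk r x) hq

theorem coupledIter_congr {η η' : CouplingSeed M} (h₁ : η'.1 = η.1) {k : ℕ}
    (h : ∀ j < k, η'.2 j = η.2 j) :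
    coupledIter P π V r x η' k = coupledIter P π V r x η k := by
  induction k with
  | zero => exact h₁
  | succ k ih =>
    rw [coupledIter, coupledIter, ih fun j hj => h j (hj.trans k.lt_succ_self), h k k.lt_succ_self]

end Coupling

/-! ### Insensitivity to the service time in progress -/

section Insensitivity

variable {P : Policy T M R} {r : R} {x x' : ServiceTimes M} {m : Fin M} {τ : ℝ≥0∞} {q : ℕ}

/-- While service `q` is in progress at time `τ`, the starts up to time `τ` do not depend on its
duration. -/
theorem Policy.agreeTo_of_inService (hq : (P.run (r, x)).InService x m τ q)
    (hx : ∀ s, s ≠ (P.run (r, x)).slot q → x' s = x s)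
    (hx' : τ < (P.run (r, x)).start q + (x' ((P.run (r, x)).slot q) : ℝ≥0∞)) {p : ℕ}
    (hp : (P.run (r, x)).start p ≤ τ) : (P.run (r, x)).AgreeTo (P.run (r, x')) p := by
  refine P.agreeTo_of_observed fun j _ => ?_
  by_cases hj : (P.run (r, x)).slot j = (P.run (r, x)).slot q
  · obtain rfl := Schedule.slot_injective _ hj
    exact Or.inr ⟨hp.trans_lt hq.2.2, hp.trans_lt hx'⟩
  · exact Or.inl (hx _ hj).symm

theorem Policy.inService_of_inService (hq : (P.run (r, x)).InService x m τ q)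
    (hx : ∀ s, s ≠ (P.run (r, x)).slot q → x' s = x s)
    (hx' : τ < (P.run (r, x)).start q + (x' ((P.run (r, x)).slot q) : ℝ≥0∞)) :
    (P.run (r, x')).InService x' m τ q := by
  obtain ⟨h1, h2, h3⟩ := Policy.agreeTo_of_inService hq hx hx' hq.2.1 q le_rfl
  refine ⟨h2.trans hq.1, h1.trans_le hq.2.1, ?_⟩
  rwa [Schedule.finish, h1, h3]

/-- While service `q` is in progress at time `τ`, the other services in progress up to time `τ` do
not depend on its duration. -/
theorem Policy.inService_transfer (hq : (P.run (r, x)).InService x m τ q)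
    (hx : ∀ s, s ≠ (P.run (r, x)).slot q → x' s = x s)
    (hx' : τ < (P.run (r, x)).start q + (x' ((P.run (r, x)).slot q) : ℝ≥0∞))
    {m' : Fin M} {τ' : ℝ≥0∞} (hτ : τ' ≤ τ) {p : ℕ} (hpq : p ≠ q)
    (hp : (P.run (r, x)).InService x m' τ' p) :
    (P.run (r, x')).InService x' m' τ' p ∧ (P.run (r, x')).start p = (P.run (r, x)).start p ∧
      x' ((P.run (r, x')).slot p) = x ((P.run (r, x)).slot p) := by
  obtain ⟨h1, h2, h3⟩ := Policy.agreeTo_of_inService hq hx hx' (hp.2.1.trans hτ) p le_rfl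
  have h4 : x' ((P.run (r, x)).slot p) = x ((P.run (r, x)).slot p) :=
    hx _ fun h => hpq (Schedule.slot_injective _ h)
  refine ⟨⟨h2.trans hp.1, h1.trans_le hp.2.1, ?_⟩, h1, by rw [h3, h4]⟩
  rw [Schedule.finish, h1, h3, h4]
  exact hp.2.2

/-- While service `q` is in progress at time `τ`, a duration that `coupledTime` determines at a time
`τ' ≤ τ` without using service `q` does not depend on the duration of `q`. -/
theorem coupledTime_congr (V : ℝ≥0 → ℝ≥0 → unitInterval → ℝ≥0)
    (hq : (P.run (r, x)).InService x m τ q)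
    (hx : ∀ s, s ≠ (P.run (r, x)).slot q → x' s = x s)
    (hx' : τ < (P.run (r, x)).start q + (x' ((P.run (r, x)).slot q) : ℝ≥0∞))
    {m' : Fin M} {τ' : ℝ≥0∞} (hτ : τ' ≤ τ) (hno : ¬ (P.run (r, x)).InService x m' τ' q)
    (w : unitInterval × ℝ≥0) :
    coupledTime V (P.run (r, x')) x' m' τ' w = coupledTime V (P.run (r, x)) x m' τ' w := by
  obtain ⟨hs1, hs2, hs3⟩ := Policy.agreeTo_of_inService hq hx hx' hq.2.1 q le_rfl
  have hq' := Policy.inService_of_inService hq hx hx'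
  have hback : ∀ p, (P.run (r, x')).InService x' m' τ' p → (P.run (r, x)).InService x m' τ' p := by
    intro p hp
    have hpq : p ≠ q := by
      rintro rfl
      exact hno ⟨hs2.symm.trans hp.1, hs1.symm.trans_le hp.2.1, hτ.trans_lt hq.2.2⟩
    refine (Policy.inService_transfer hq' (fun s hs => ?_) ?_ hτ hpq hp).1
    · exact (hx s (hs3 ▸ hs)).symm
    · rw [hs1, hs3]
      exact hq.2.2
  by_cases h : ∃ p, (P.run (r, x)).InService x m' τ' p
  · obtain ⟨p, hp⟩ := h
    have hpq : p ≠ q := by rintro rfl; exact hno hp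
    obtain ⟨h1, h2, h3⟩ := Policy.inService_transfer hq hx hx' hτ hpq hp
    rw [coupledTime_of_inService (P.feasible_mk r x) hp,
      coupledTime_of_inService (P.feasible_mk r x') h1, h2, h3]
  · rw [coupledTime_of_not_inService h,
      coupledTime_of_not_inService fun ⟨p, hp⟩ => h ⟨p, hback p hp⟩]

/-- If start number `k` of the second system takes place during service `q` of the first system on
the same server, then what the coupling has determined before does not depend on the duration of
`q`: an earlier start during `q` on this server would belong to a service that lasts at least until
the completion of `q`. -/
theorem coupledIter_congr_of_inService {π : Policy T M R}
    {V : ℝ≥0 → ℝ≥0 → unitInterval → ℝ≥0} (hV : ∀ s v w, v ≤ s + V s v w) {η : CouplingSeed M}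
    {k : ℕ}
    (hq : (P.run (r, x)).InService x ((π.run (r, coupledIter P π V r x η k)).server k)
      ((π.run (r, coupledIter P π V r x η k)).start k) q)
    (hx : ∀ s, s ≠ (P.run (r, x)).slot q → x' s = x s)
    (hx' : (π.run (r, coupledIter P π V r x η k)).start k <
      (P.run (r, x)).start q + (x' ((P.run (r, x)).slot q) : ℝ≥0∞)) :
    coupledIter P π V r x' η k = coupledIter P π V r x η k := by
  suffices h : ∀ j ≤ k, coupledIter P π V r x' η j = coupledIter P π V r x η j from h k le_rfl
  intro j
  induction j with
  | zero => exact fun _ => rfl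
  | succ j ih =>
    intro hj
    rw [coupledIter, coupledIter, ih (Nat.le_of_succ_le hj)]
    obtain ⟨h1, h2, h3⟩ := agreeTo_coupledIter P π V r x η (Nat.le_of_succ_le hj) j le_rfl
    have hfeas := π.feasible_mk r (coupledIter P π V r x η k)
    rw [coupledTime_congr V hq hx hx' (h1 ▸ hfeas.start_mono (Nat.le_of_succ_le hj))]
    intro hjq
    have hfin := finish_le_add_coupledTime (w := η.2 j) hV (P.feasible_mk r x) hjq
    have hnp := hfeas.nonpreemptive j k hj (hq.2.2.trans_le le_top).ne
      (h2.trans (hjq.1.symm.trans hq.1))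
    rw [Schedule.finish, h3, coupledIter_slot P π V r x η hj, h1] at hnp
    exact absurd hq.2.2 (not_lt.2 (hfin.trans hnp))

end Insensitivity

/-! ### Measurability of the coupling -/

section Measurability

variable {A : Type*} [MeasurableSpace A]

theorem measurable_apply_of_countable {ι α : Type*} [Countable ι] [MeasurableSpace ι]
    [MeasurableSingletonClass ι] [MeasurableSpace α] {y : A → ι → α} {s : A → ι}
    (hy : Measurable y) (hs : Measurable s) : Measurable fun z => y z (s z) :=
  (measurable_from_prod_countable_left (f := fun p : (ι → α) × ι => p.1 p.2)
    fun i => measurable_pi_apply i).comp (hy.prodMk hs)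

theorem measurable_update_random {ι α : Type*} [DecidableEq ι] [Countable ι] [MeasurableSpace ι]
    [MeasurableSingletonClass ι] [MeasurableSpace α] {y : A → ι → α} {s : A → ι} {v : A → α}
    (hy : Measurable y) (hs : Measurable s) (hv : Measurable v) :
    Measurable fun z => Function.update (y z) (s z) (v z) := by
  refine measurable_pi_iff.2 fun i => ?_
  simp only [Function.update_apply]
  exact Measurable.ite (measurableSet_eq_fun measurable_const hs) hv
    ((measurable_pi_apply i).comp hy)

theorem Policy.measurable_slot (π : Policy T M R) (k : ℕ) :
    Measurable fun ω => (π.run ω).slot k := by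
  refine (π.measurable_server k).prodMk ?_
  simp only [Finset.card_filter]
  exact Finset.measurable_sum _ fun j _ => Measurable.ite
    (measurableSet_eq_fun (π.measurable_server j) (π.measurable_server k))
    measurable_const measurable_const

variable (P : Policy T M R) {ω : A → Sample R M} {m : A → Fin M} {τ : A → ℝ≥0∞}

theorem Policy.measurableSet_inService (hω : Measurable ω) (hm : Measurable m)
    (hτ : Measurable τ) (q : ℕ) :
    MeasurableSet {z | (P.run (ω z)).InService (ω z).2 (m z) (τ z) q} := by
  have hstart : Measurable fun z => (P.run (ω z)).start q := (P.measurable_start q).comp hω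
  have hfin : Measurable fun z => (P.run (ω z)).finish (ω z).2 q :=
    hstart.add (measurable_apply_of_countable (measurable_snd.comp hω)
      ((P.measurable_slot q).comp hω)).coe_nnreal_ennreal
  exact (measurableSet_eq_fun ((P.measurable_server q).comp hω) hm).inter
    ((measurableSet_le hstart hτ).inter (measurableSet_lt hτ hfin))

theorem measurable_coupledTime {V : ℝ≥0 → ℝ≥0 → unitInterval → ℝ≥0}
    (hV : Measurable fun q : (ℝ≥0 × ℝ≥0) × unitInterval => V q.1.1 q.1.2 q.2)
    {w : A → unitInterval × ℝ≥0} (hω : Measurable ω) (hm : Measurable m) (hτ : Measurable τ)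
    (hw : Measurable w) :
    Measurable fun z => coupledTime V (P.run (ω z)) (ω z).2 (m z) (τ z) (w z) := by
  have hval : ∀ q, Measurable fun z =>
      V (τ z - (P.run (ω z)).start q).toNNReal ((ω z).2 ((P.run (ω z)).slot q)) (w z).1 :=
    fun q => hV.comp (((hτ.sub ((P.measurable_start q).comp hω)).ennreal_toNNReal.prodMk
      (measurable_apply_of_countable (measurable_snd.comp hω)
        ((P.measurable_slot q).comp hω))).prodMk (measurable_fst.comp hw))
  intro B hB
  have : (fun z => coupledTime V (P.run (ω z)) (ω z).2 (m z) (τ z) (w z)) ⁻¹' B =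
      (⋃ q, {z | (P.run (ω z)).InService (ω z).2 (m z) (τ z) q} ∩
        {z | V (τ z - (P.run (ω z)).start q).toNNReal ((ω z).2 ((P.run (ω z)).slot q))
          (w z).1 ∈ B}) ∪
      ((⋃ q, {z | (P.run (ω z)).InService (ω z).2 (m z) (τ z) q})ᶜ ∩ {z | (w z).2 ∈ B}) := by
    ext z
    simp only [Set.mem_preimage, Set.mem_union, Set.mem_iUnion, Set.mem_inter_iff,
      Set.mem_ofPred_eq, Set.mem_compl_iff]
    by_cases h : ∃ q, (P.run (ω z)).InService (ω z).2 (m z) (τ z) q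
    · obtain ⟨q, hq⟩ := h
      rw [coupledTime_of_inService (P.feasible _) hq]
      refine ⟨fun hB => Or.inl ⟨q, hq, hB⟩, ?_⟩
      rintro (⟨q', hq', hB⟩ | ⟨hno, -⟩)
      · rwa [Schedule.InService.unique (P.feasible _) hq hq']
      · exact absurd ⟨q, hq⟩ hno
    · rw [coupledTime_of_not_inService h]
      refine ⟨fun hB => Or.inr ⟨h, hB⟩, ?_⟩
      rintro (⟨q', hq', -⟩ | ⟨-, hB⟩)
      · exact absurd ⟨q', hq'⟩ h
      · exact hB
  rw [this]
  have hS := P.measurableSet_inService hω hm hτ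
  exact (MeasurableSet.iUnion fun q => (hS q).inter (hval q hB)).union
    ((MeasurableSet.iUnion hS).compl.inter ((measurable_snd.comp hw) hB))

variable (π : Policy T M R) {V : ℝ≥0 → ℝ≥0 → unitInterval → ℝ≥0}

theorem measurable_coupledIter
    (hV : Measurable fun q : (ℝ≥0 × ℝ≥0) × unitInterval => V q.1.1 q.1.2 q.2) (k : ℕ) :
    Measurable fun z : R × ServiceTimes M × CouplingSeed M =>
      coupledIter P π V z.1 z.2.1 z.2.2 k := by
  induction k with
  | zero => exact measurable_fst.comp (measurable_snd.comp measurable_snd)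
  | succ k ih =>
    have h1 := measurable_fst.prodMk ih
    have h2 : Measurable fun z : R × ServiceTimes M × CouplingSeed M => z.2.2.2 k :=
      (measurable_pi_apply k).comp (measurable_snd.comp (measurable_snd.comp measurable_snd))
    exact measurable_update_random ih ((π.measurable_slot k).comp h1)
      (measurable_coupledTime P hV (measurable_fst.prodMk (measurable_fst.comp measurable_snd))
        ((π.measurable_server k).comp h1) ((π.measurable_start k).comp h1) h2)

theorem measurable_coupledTimes
    (hV : Measurable fun q : (ℝ≥0 × ℝ≥0) × unitInterval => V q.1.1 q.1.2 q.2) :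
    Measurable fun z : R × ServiceTimes M × CouplingSeed M =>
      coupledTimes P π V z.1 z.2.1 z.2.2 := by
  refine measurable_pi_iff.2 fun s => measurable_of_tendsto_metrizable
    (fun k => (measurable_pi_apply s).comp (measurable_coupledIter P π hV k))
    (tendsto_pi_nhds.2 fun z => tendsto_nhds_of_eventually_eq
      (eventually_coupledIter_eq P π V z.1 z.2.1 z.2.2 s))

end Measurability

/-! ### Law of the coupled service times -/

/-- The law of `CouplingSeed`: all components are independent. -/
def couplingLaw (M : ℕ) (μ : Measure ℝ≥0) [IsProbabilityMeasure μ] : Measure (CouplingSeed M) :=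
  (Measure.infinitePi fun _ : Fin M × ℕ => μ).prod
    (Measure.infinitePi fun _ : ℕ => (volume : Measure unitInterval).prod μ)

instance (M : ℕ) (μ : Measure ℝ≥0) [IsProbabilityMeasure μ] :
    IsProbabilityMeasure (couplingLaw M μ) := by
  unfold couplingLaw; infer_instance

section Law

variable (P π : Policy T M R) {V : ℝ≥0 → ℝ≥0 → unitInterval → ℝ≥0} (r : R)
  {μ : Measure ℝ≥0} [IsProbabilityMeasure μ]

/-- For a fixed starting point of the coupling, the duration that `coupledTime` gives to a service
which begins during service `q` of the first system is a fresh service time, once the total duration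
`v` of service `q` is averaged over the values compatible with its being in progress. -/
theorem setLIntegral_update_coupledTime (hV : IsResidualCoupling μ V)
    {h : ServiceTimes M → ℝ≥0∞} (hh : Measurable h) (k : ℕ) (x : ServiceTimes M)
    (η : CouplingSeed M) (c : Fin M × ℕ) :
    ∫⁻ v, Set.indicator
      {x | ∃ q, (P.run (r, x)).InService x ((π.run (r, coupledIter P π V r x η k)).server k)
        ((π.run (r, coupledIter P π V r x η k)).start k) q ∧ (P.run (r, x)).slot q = c}
      (fun x => ∫⁻ w, h (Function.update (coupledIter P π V r x η k)
        ((π.run (r, coupledIter P π V r x η k)).slot k)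
        (coupledTime V (P.run (r, x)) x ((π.run (r, coupledIter P π V r x η k)).server k)
          ((π.run (r, coupledIter P π V r x η k)).start k) w))
        ∂((volume : Measure unitInterval).prod μ)) (Function.update x c v) ∂μ =
    ∫⁻ v, Set.indicator
      {x | ∃ q, (P.run (r, x)).InService x ((π.run (r, coupledIter P π V r x η k)).server k)
        ((π.run (r, coupledIter P π V r x η k)).start k) q ∧ (P.run (r, x)).slot q = c}
      (fun x => ∫⁻ u, h (Function.update (coupledIter P π V r x η k)
        ((π.run (r, coupledIter P π V r x η k)).slot k) u) ∂μ) (Function.update x c v) ∂μ := by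
  set E : Set (ServiceTimes M) :=
    {x | ∃ q, (P.run (r, x)).InService x ((π.run (r, coupledIter P π V r x η k)).server k)
      ((π.run (r, coupledIter P π V r x η k)).start k) q ∧ (P.run (r, x)).slot q = c} with hE
  by_cases hex : ∃ v₀, Function.update x c v₀ ∈ E
  swap
  · push Not at hex
    simp only [Set.indicator_of_notMem (hex _)]
  -- on the event, everything but the duration of the service in progress is frozen
  have frozen : ∀ v₀, Function.update x c v₀ ∈ E → ∃ (s : ℝ≥0) (q : ℕ) (y : ServiceTimes M),
      s < v₀ ∧ ∀ v, s < v →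
      coupledIter P π V r (Function.update x c v) η k = y ∧
      (P.run (r, Function.update x c v)).InService (Function.update x c v)
        ((π.run (r, y)).server k) ((π.run (r, y)).start k) q ∧
      (P.run (r, Function.update x c v)).slot q = c ∧
      ((π.run (r, y)).start k - (P.run (r, Function.update x c v)).start q).toNNReal = s := by
    rintro v₀ ⟨q, hq, hqc⟩
    set x₀ := Function.update x c v₀
    have hτ : (π.run (r, coupledIter P π V r x₀ η k)).start k ≠ ⊤ := (hq.2.2.trans_le le_top).ne
    have hs : (P.run (r, x₀)).start q + (((π.run (r, coupledIter P π V r x₀ η k)).start k -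
        (P.run (r, x₀)).start q).toNNReal : ℝ≥0∞) =
        (π.run (r, coupledIter P π V r x₀ η k)).start k := by
      rw [ENNReal.coe_toNNReal (ne_top_of_le_ne_top hτ tsub_le_self)]
      exact add_tsub_cancel_of_le hq.2.1
    have hst : (P.run (r, x₀)).start q ≠ ⊤ := ne_top_of_le_ne_top hτ hq.2.1
    refine ⟨((π.run (r, coupledIter P π V r x₀ η k)).start k -
        (P.run (r, x₀)).start q).toNNReal, q, coupledIter P π V r x₀ η k, ?_, fun v hv => ?_⟩
    · have := hq.2.2
      rw [← hs, Schedule.finish, ENNReal.add_lt_add_iff_left hst, hqc, ENNReal.coe_lt_coe] at this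
      simpa [x₀] using this
    · have hx : ∀ s, s ≠ (P.run (r, x₀)).slot q → Function.update x c v s = x₀ s := by
        intro s hsc
        rw [hqc] at hsc
        simp [x₀, Function.update_of_ne hsc]
      have hx' : (π.run (r, coupledIter P π V r x₀ η k)).start k <
          (P.run (r, x₀)).start q +
            (Function.update x c v ((P.run (r, x₀)).slot q) : ℝ≥0∞) := by
        rw [← hs, ENNReal.add_lt_add_iff_left hst, hqc, ENNReal.coe_lt_coe]
        simpa using hv
      obtain ⟨h1, h2, h3⟩ := Policy.agreeTo_of_inService hq hx hx' hq.2.1 q le_rfl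
      exact ⟨coupledIter_congr_of_inService hV.le_add hq hx hx',
        Policy.inService_of_inService hq hx hx', h3.trans hqc, by rw [h1]⟩
  obtain ⟨v₀, hv₀⟩ := hex
  obtain ⟨s, q, y, hsv, hfr⟩ := frozen v₀ hv₀
  have hmem : ∀ v, Function.update x c v ∈ E ↔ v ∈ Set.Ioi s := by
    intro v
    constructor
    · intro hv
      obtain ⟨s', q', y', hsv', hfr'⟩ := frozen v hv
      obtain ⟨a1, a2, a3, a4⟩ := hfr (max v v₀) (hsv.trans_le (le_max_right _ _))
      obtain ⟨b1, b2, b3, b4⟩ := hfr' (max v v₀) (hsv'.trans_le (le_max_left _ _))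
      obtain rfl : y = y' := a1.symm.trans b1
      obtain rfl := Schedule.InService.unique (P.feasible_mk r _) a2 b2
      rw [Set.mem_Ioi, ← a4, b4]
      exact hsv'
    · intro hv
      obtain ⟨a1, a2, a3, -⟩ := hfr v hv
      exact ⟨q, by rwa [a1], a3⟩
  have hind : ∀ (F : ServiceTimes M → ℝ≥0∞) v, E.indicator F (Function.update x c v) =
      (Set.Ioi s).indicator (fun v => F (Function.update x c v)) v := by
    intro F v
    by_cases hv : v ∈ Set.Ioi s
    · rw [Set.indicator_of_mem hv, Set.indicator_of_mem ((hmem v).2 hv)]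
    · rw [Set.indicator_of_notMem hv, Set.indicator_of_notMem fun h => hv ((hmem v).1 h)]
  simp only [hind, lintegral_indicator measurableSet_Ioi]
  have hg : Measurable fun u => h (Function.update y ((π.run (r, y)).slot k) u) :=
    hh.comp (measurable_update _)
  calc _ = ∫⁻ v in Set.Ioi s,
        (∫⁻ w, h (Function.update y ((π.run (r, y)).slot k) (V s v w))) ∂μ := by
        refine setLIntegral_congr_fun measurableSet_Ioi fun v hv => ?_
        obtain ⟨a1, a2, a3, a4⟩ := hfr v hv
        rw [a1]
        simp only [coupledTime_of_inService (P.feasible_mk r _) a2, a3, a4, Function.update_self]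
        have hm : Measurable fun w : unitInterval =>
            h (Function.update y ((π.run (r, y)).slot k) (V s v w)) :=
          hg.comp (hV.measurable.comp (measurable_prodMk_left (x := (s, v))))
        rw [← measurePreserving_fst.lintegral_comp hm (μ := volume.prod μ)]
    _ = _ := by
        rw [hV.law s _ hg]
        refine setLIntegral_congr_fun measurableSet_Ioi fun v hv => ?_
        rw [(hfr v hv).1]

/-- Each step of the coupling produces i.i.d. service times with law `μ`. -/
theorem lintegral_coupledIter (hV : IsResidualCoupling μ V)
    (k : ℕ) {h : ServiceTimes M → ℝ≥0∞} (hh : Measurable h) :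
    ∫⁻ z, h (coupledIter P π V r z.1 z.2 k)
      ∂((Measure.infinitePi fun _ : Fin M × ℕ => μ).prod (couplingLaw M μ)) =
    ∫⁻ y, h y ∂(Measure.infinitePi fun _ : Fin M × ℕ => μ) := by
  induction k generalizing h with
  | zero =>
    have h1 : MeasurePreserving (fun z : ServiceTimes M × CouplingSeed M => z.2.1)
        ((Measure.infinitePi fun _ : Fin M × ℕ => μ).prod (couplingLaw M μ))
        (Measure.infinitePi fun _ : Fin M × ℕ => μ) :=
      measurePreserving_fst.comp measurePreserving_snd
    exact h1.lintegral_comp hh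
  | succ k ih =>
    have hiter : Measurable fun z : ServiceTimes M × CouplingSeed M =>
        coupledIter P π V r z.1 z.2 k :=
      (measurable_coupledIter P π hV.measurable k).comp measurable_prodMk_left
    have hrun : Measurable fun z : ServiceTimes M × CouplingSeed M =>
        (r, coupledIter P π V r z.1 z.2 k) := measurable_const.prodMk hiter
    have hct : Measurable fun q : (ServiceTimes M × CouplingSeed M) × (unitInterval × ℝ≥0) =>
        coupledTime V (P.run (r, q.1.1)) q.1.1
          ((π.run (r, coupledIter P π V r q.1.1 q.1.2 k)).server k)
          ((π.run (r, coupledIter P π V r q.1.1 q.1.2 k)).start k) q.2 :=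
      measurable_coupledTime P hV.measurable
        (measurable_const.prodMk (measurable_fst.comp measurable_fst))
        ((π.measurable_server k).comp (hrun.comp measurable_fst))
        ((π.measurable_start k).comp (hrun.comp measurable_fst)) measurable_snd
    have hslot : Measurable fun z : ServiceTimes M × CouplingSeed M =>
        (π.run (r, coupledIter P π V r z.1 z.2 k)).slot k := (π.measurable_slot k).comp hrun
    -- one step, with the new duration given by `coupledTime` and by a fresh service time
    let J : ServiceTimes M × CouplingSeed M → ℝ≥0∞ := fun z =>
      ∫⁻ w, h (Function.update (coupledIter P π V r z.1 z.2 k)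
        ((π.run (r, coupledIter P π V r z.1 z.2 k)).slot k)
        (coupledTime V (P.run (r, z.1)) z.1
          ((π.run (r, coupledIter P π V r z.1 z.2 k)).server k)
          ((π.run (r, coupledIter P π V r z.1 z.2 k)).start k) w))
        ∂((volume : Measure unitInterval).prod μ)
    let J' : ServiceTimes M × CouplingSeed M → ℝ≥0∞ := fun z =>
      ∫⁻ u, h (Function.update (coupledIter P π V r z.1 z.2 k)
        ((π.run (r, coupledIter P π V r z.1 z.2 k)).slot k) u) ∂μ
    have hJ : Measurable J := Measurable.lintegral_prod_right' (f := fun q :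
        (ServiceTimes M × CouplingSeed M) × (unitInterval × ℝ≥0) => h (Function.update
          (coupledIter P π V r q.1.1 q.1.2 k)
          ((π.run (r, coupledIter P π V r q.1.1 q.1.2 k)).slot k) (coupledTime V
            (P.run (r, q.1.1)) q.1.1 ((π.run (r, coupledIter P π V r q.1.1 q.1.2 k)).server k)
            ((π.run (r, coupledIter P π V r q.1.1 q.1.2 k)).start k) q.2)))
      (hh.comp (measurable_update_random (hiter.comp measurable_fst)
        (hslot.comp measurable_fst) hct))
    have hJ' : Measurable J' := Measurable.lintegral_prod_right' (f := fun q :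
        (ServiceTimes M × CouplingSeed M) × ℝ≥0 => h (Function.update
          (coupledIter P π V r q.1.1 q.1.2 k)
          ((π.run (r, coupledIter P π V r q.1.1 q.1.2 k)).slot k) q.2))
      (hh.comp (measurable_update_random (hiter.comp measurable_fst)
        (hslot.comp measurable_fst) measurable_snd))
    have hcoupled : ∫⁻ z, h (coupledIter P π V r z.1 z.2 (k + 1))
        ∂((Measure.infinitePi fun _ : Fin M × ℕ => μ).prod (couplingLaw M μ)) =
        ∫⁻ z, J z ∂((Measure.infinitePi fun _ : Fin M × ℕ => μ).prod (couplingLaw M μ)) := by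
      have hm : Measurable fun z : ServiceTimes M × CouplingSeed M =>
          h (coupledIter P π V r z.1 z.2 (k + 1)) :=
        hh.comp ((measurable_coupledIter P π hV.measurable (k + 1)).comp measurable_prodMk_left)
      rw [lintegral_prod _ hm.aemeasurable, lintegral_prod _ hJ.aemeasurable]
      refine lintegral_congr fun x => ?_
      have hmx : Measurable fun η : CouplingSeed M => h (coupledIter P π V r x η (k + 1)) :=
        hm.comp measurable_prodMk_left
      have hJx : Measurable fun η : CouplingSeed M => J (x, η) := hJ.comp measurable_prodMk_left
      refine (lintegral_prod _ hmx.aemeasurable).trans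
        (Eq.trans ?_ (lintegral_prod _ hJx.aemeasurable).symm)
      refine lintegral_congr fun d => ?_
      have hmd : Measurable fun e => h (coupledIter P π V r x (d, e) (k + 1)) :=
        hmx.comp measurable_prodMk_left
      rw [← lintegral_infinitePi_update _ k hmd]
      refine lintegral_congr fun e => lintegral_congr fun w => ?_
      simp only [coupledIter, Function.update_self]
      rw [coupledIter_congr P π V r x (η := (d, e)) (η' := (d, Function.update e k w)) rfl
        fun j hj => Function.update_of_ne hj.ne _ _]
    have hresample :
        ∫⁻ z, J z ∂((Measure.infinitePi fun _ : Fin M × ℕ => μ).prod (couplingLaw M μ)) =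
        ∫⁻ z, J' z ∂((Measure.infinitePi fun _ : Fin M × ℕ => μ).prod (couplingLaw M μ)) := by
      -- split according to the slot of the service in progress, if any
      let E : Option (Fin M × ℕ) → Set (ServiceTimes M × CouplingSeed M)
        | none => (⋃ q, {z | (P.run (r, z.1)).InService z.1
            ((π.run (r, coupledIter P π V r z.1 z.2 k)).server k)
            ((π.run (r, coupledIter P π V r z.1 z.2 k)).start k) q})ᶜ
        | some c => {z | ∃ q, (P.run (r, z.1)).InService z.1
            ((π.run (r, coupledIter P π V r z.1 z.2 k)).server k)
            ((π.run (r, coupledIter P π V r z.1 z.2 k)).start k) q ∧ (P.run (r, z.1)).slot q = c}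
      have hP : Measurable fun z : ServiceTimes M × CouplingSeed M => (r, z.1) :=
        measurable_const.prodMk measurable_fst
      have hS := P.measurableSet_inService hP ((π.measurable_server k).comp hrun)
        ((π.measurable_start k).comp hrun)
      have hEm : ∀ o, MeasurableSet (E o) := by
        rintro (_ | c)
        · exact (MeasurableSet.iUnion hS).compl
        · simp only [E, Set.ofPred_exists]
          exact MeasurableSet.iUnion fun q => (hS q).inter
            (measurableSet_eq_fun ((P.measurable_slot q).comp hP) measurable_const)
      have hEd : Pairwise (Function.onFun Disjoint E) := by
        have hns : ∀ c, Disjoint (E none) (E (some c)) := fun c =>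
          Set.disjoint_left.2 fun z hz ⟨q, hq, _⟩ => hz (Set.mem_iUnion.2 ⟨q, hq⟩)
        rintro (_ | c) (_ | c') hcc
        · exact absurd rfl hcc
        · exact hns c'
        · exact (hns c).symm
        · refine Set.disjoint_left.2 ?_
          rintro z ⟨q, hq, rfl⟩ ⟨q', hq', rfl⟩
          exact hcc (by rw [Schedule.InService.unique (P.feasible_mk r _) hq hq'])
      have hEu : ⋃ o, E o = Set.univ := by
        refine Set.eq_univ_of_forall fun z => Set.mem_iUnion.2 ?_
        by_cases hz : z ∈ E none
        · exact ⟨none, hz⟩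
        · obtain ⟨q, hq⟩ := Set.mem_iUnion.1 (not_not.1 hz)
          exact ⟨some _, q, hq, rfl⟩
      rw [← setLIntegral_univ, ← setLIntegral_univ J', ← hEu, lintegral_iUnion hEm hEd,
        lintegral_iUnion hEm hEd]
      refine tsum_congr fun o => ?_
      rcases o with _ | c
      · refine setLIntegral_congr_fun (hEm none) fun z hz => ?_
        have hno : ¬ ∃ q, (P.run (r, z.1)).InService z.1
            ((π.run (r, coupledIter P π V r z.1 z.2 k)).server k)
            ((π.run (r, coupledIter P π V r z.1 z.2 k)).start k) q := fun ⟨q, hq⟩ =>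
          hz (Set.mem_iUnion.2 ⟨q, hq⟩)
        simp only [J, J', coupledTime_of_not_inService hno]
        exact measurePreserving_snd.lintegral_comp (hh.comp (measurable_update _))
      · rw [← lintegral_indicator (hEm (some c)) J, ← lintegral_indicator (hEm (some c)) J']
        have hi := hJ.indicator (hEm (some c))
        have hi' := hJ'.indicator (hEm (some c))
        refine (lintegral_prod_symm _ hi.aemeasurable).trans
          (Eq.trans ?_ (lintegral_prod_symm _ hi'.aemeasurable).symm)
        refine lintegral_congr fun η => ?_
        refine (lintegral_infinitePi_update μ c (hi.comp measurable_prodMk_right)).symm.trans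
          (Eq.trans ?_ (lintegral_infinitePi_update μ c (hi'.comp measurable_prodMk_right)))
        exact lintegral_congr fun x =>
          setLIntegral_update_coupledTime P π r hV hh k x η c
    have hH : Measurable fun y : ServiceTimes M =>
        ∫⁻ u, h (Function.update y ((π.run (r, y)).slot k) u) ∂μ :=
      Measurable.lintegral_prod_right' (f := fun q : ServiceTimes M × ℝ≥0 =>
        h (Function.update q.1 ((π.run (r, q.1)).slot k) q.2))
        (hh.comp (measurable_update_random measurable_fst
          ((π.measurable_slot k).comp (measurable_const.prodMk measurable_fst)) measurable_snd))
    rw [hcoupled, hresample]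
    refine (ih hH).trans (lintegral_infinitePi_update_random μ
      ((π.measurable_slot k).comp measurable_prodMk_left) (fun x v => ?_) hh)
    exact (π.agreeTo_update_slot r x k v k le_rfl).2.2

theorem map_coupledTimes (hV : IsResidualCoupling μ V) :
    ((Measure.infinitePi fun _ : Fin M × ℕ => μ).prod (couplingLaw M μ)).map
      (fun z => coupledTimes P π V r z.1 z.2) = Measure.infinitePi fun _ : Fin M × ℕ => μ := by
  have hm : Measurable fun z : ServiceTimes M × CouplingSeed M => coupledTimes P π V r z.1 z.2 :=
    (measurable_coupledTimes P π hV.measurable).comp measurable_prodMk_left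
  have hmk : ∀ k, Measurable fun z : ServiceTimes M × CouplingSeed M =>
      coupledIter P π V r z.1 z.2 k :=
    fun k => (measurable_coupledIter P π hV.measurable k).comp measurable_prodMk_left
  refine Measure.eq_infinitePi _ fun S t ht => ?_
  have hB : MeasurableSet (Set.pi (S : Set (Fin M × ℕ)) t) :=
    MeasurableSet.pi S.countable_toSet fun i _ => ht i
  rw [Measure.map_apply hm hB, ← Measure.infinitePi_pi (fun _ => μ) (fun i _ => ht i)]
  refine tendsto_nhds_unique (tendsto_measure_of_ae_tendsto_indicator_of_isFiniteMeasure
    Filter.atTop (hm hB) (fun k => hmk k hB) (Filter.Eventually.of_forall fun z => ?_)) ?_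
  · have hev : ∀ᶠ k in Filter.atTop, ∀ s ∈ S,
        coupledIter P π V r z.1 z.2 k s = coupledTimes P π V r z.1 z.2 s :=
      (Filter.eventually_all_finset S).2 fun s _ => eventually_coupledIter_eq P π V r z.1 z.2 s
    filter_upwards [hev] with k hk
    simp only [Set.mem_preimage, Set.mem_pi, Finset.mem_coe]
    exact forall₂_congr fun s hs => by rw [hk s hs]
  · refine tendsto_const_nhds.congr fun k => ?_
    have := lintegral_coupledIter P π r hV k (measurable_const.indicator hB
      (f := fun _ => (1 : ℝ≥0∞)))
    rw [lintegral_indicator_const hB, one_mul] at this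
    rw [← this, ← one_mul (Measure.prod _ _ _), ← lintegral_indicator_const (hmk k hB)]
    rfl

end Law

/-! ### The coupling of the two systems -/

/-- For every policy `π` there is a coupling of the systems with policies `P` and `π`, with the
sample point of `π` built from that of `P` and an independent seed, in which all age penalties of
`π` dominate the penalties of the Age of Served Information of `P` on every sample path. -/
theorem Policy.IsMASIFLGFS.exists_coupling {ν : Measure R} [IsProbabilityMeasure ν]
    {μ : Measure ℝ≥0} [IsProbabilityMeasure μ] (hμ : IsNBU μ) (hT : T.Synchronized)
    {a : Fin N → ℝ≥0} {P : Policy T M R} (hP : P.IsMASIFLGFS a)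
    {p : ℝ≥0 → (Fin N → ℝ≥0) → ℝ} (hp : ∀ t, IsSymmPenalty (p t)) (π : Policy T M R) :
    ∃ G : Sample R M × CouplingSeed M → Sample R M,
      MeasurePreserving G ((law M ν μ).prod (couplingLaw M μ)) (law M ν μ) ∧
      ∀ z t, P.servedAgePenalty a p t z.1 ≤ π.agePenalty a p t (G z) := by
  obtain ⟨V, hV⟩ := hμ.exists_residual_coupling
  have h1 : MeasurePreserving (fun z : R × ServiceTimes M × CouplingSeed M =>
      (z.1, coupledTimes P π V z.1 z.2.1 z.2.2))
      (ν.prod ((Measure.infinitePi fun _ : Fin M × ℕ => μ).prod (couplingLaw M μ)))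
      (law M ν μ) :=
    (MeasurePreserving.id ν).skew_product
      (g := fun r (z : ServiceTimes M × CouplingSeed M) => coupledTimes P π V r z.1 z.2)
      (measurable_coupledTimes P π hV.measurable)
      (Filter.Eventually.of_forall fun r => map_coupledTimes P π r hV)
  have h2 : MeasurePreserving (MeasurableEquiv.prodAssoc :
      (R × ServiceTimes M) × CouplingSeed M ≃ᵐ R × ServiceTimes M × CouplingSeed M)
      ((law M ν μ).prod (couplingLaw M μ))
      (ν.prod ((Measure.infinitePi fun _ : Fin M × ℕ => μ).prod (couplingLaw M μ))) :=
    measurePreserving_prodAssoc ν _ _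
  refine ⟨_, h1.comp h2, ?_⟩
  rintro ⟨⟨r, x⟩, η⟩ t
  exact Schedule.penalty_servedAge_le_age hT (P.feasible_mk r x) (hP (r, x)).1 (hP (r, x)).2
    (π.feasible_mk r _)
    (fun k q _ hq => finish_le_finish_coupledTimes P π V r x η hV.le_add k q hq) (hp t) t

section Consequences

variable {Ω E : Type*} [MeasurableSpace Ω] [MeasurableSpace E] {ℙ : Measure Ω}
  {ρ : Measure E} [IsProbabilityMeasure ρ] {G : Ω × E → Ω}
  {Y Y' : ℝ≥0 → Ω → ℝ}

/-- The events in question need not be measurable, so `ℙ` is an outer measure here. This is why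
`Y'` is coupled to `Y` by means of an extension of the probability space by an independent
component: such an extension preserves outer measures. -/
theorem stochLE_of_coupling (hG : MeasurePreserving G (ℙ.prod ρ) ℙ)
    (hY : ∀ z t, Y t z.1 ≤ Y' t (G z)) : StochLE ℙ Y ℙ Y' := by
  intro n t _ U hU
  set B := toMeasurable ℙ {ω | (fun i => Y' (t i) ω) ∈ U}
  calc ℙ {ω | (fun i => Y (t i) ω) ∈ U}
      = ℙ.prod ρ ({ω | (fun i => Y (t i) ω) ∈ U} ×ˢ Set.univ) := by
        rw [Measure.prod_prod, measure_univ, mul_one]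
    _ ≤ ℙ.prod ρ (G ⁻¹' B) := measure_mono fun z hz =>
        subset_toMeasurable _ _ (hU (fun i => hY z (t i)) hz.1)
    _ = ℙ B := hG.measure_preimage (measurableSet_toMeasurable _ _).nullMeasurableSet
    _ = _ := measure_toMeasurable _

theorem expectation_le_of_coupling (hG : MeasurePreserving G (ℙ.prod ρ) ℙ)
    (hY : ∀ z t, Y t z.1 ≤ Y' t (G z)) {φ : (ℝ≥0 → ℝ) → ℝ} (hφ : MonotoneOn φ lebesgueFunctions)
    (hex : ExpectationExists ℙ φ Y) (hex' : ExpectationExists ℙ φ Y') :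
    expectation ℙ φ Y ≤ expectation ℙ φ Y' := by
  have hfst : MeasurePreserving (Prod.fst : Ω × E → Ω) (ℙ.prod ρ) ℙ := measurePreserving_fst
  have hle : ∀ᵐ z ∂(ℙ.prod ρ), φ (fun t => Y t z.1) ≤ φ (fun t => Y' t (G z)) := by
    filter_upwards [hfst.quasiMeasurePreserving.ae hex.1, hG.quasiMeasurePreserving.ae hex'.1]
      with z hz hz'
    exact hφ hz hz' fun t => hY z t
  have hcomp : ∀ {H : Ω × E → Ω} (_ : MeasurePreserving H (ℙ.prod ρ) ℙ) {f : Ω → ℝ≥0∞},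
      AEMeasurable f ℙ → ∫⁻ z, f (H z) ∂(ℙ.prod ρ) = ∫⁻ ω, f ω ∂ℙ := by
    intro H hH f hf
    rw [← hH.map_eq] at hf
    conv_rhs => rw [← hH.map_eq]
    exact (lintegral_map' hf hH.aemeasurable).symm
  have hpos : ∫⁻ ω, ENNReal.ofReal (φ fun t => Y t ω) ∂ℙ ≤
      ∫⁻ ω, ENNReal.ofReal (φ fun t => Y' t ω) ∂ℙ := by
    rw [← hcomp hfst hex.2.1.ennreal_ofReal, ← hcomp hG hex'.2.1.ennreal_ofReal]
    exact lintegral_mono_ae (hle.mono fun z hz => ENNReal.ofReal_le_ofReal hz)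
  have hm : AEMeasurable (fun ω => -φ fun t => Y t ω) ℙ := hex.2.1.neg
  have hm' : AEMeasurable (fun ω => -φ fun t => Y' t ω) ℙ := hex'.2.1.neg
  have hneg : ∫⁻ ω, ENNReal.ofReal (-φ fun t => Y' t ω) ∂ℙ ≤
      ∫⁻ ω, ENNReal.ofReal (-φ fun t => Y t ω) ∂ℙ := by
    rw [← hcomp hfst hm.ennreal_ofReal, ← hcomp hG hm'.ennreal_ofReal]
    exact lintegral_mono_ae (hle.mono fun z hz => ENNReal.ofReal_le_ofReal (neg_le_neg hz))
  exact EReal.sub_le_sub (by exact_mod_cast hpos) (by exact_mod_cast hneg)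

end Consequences

end StatusUpdate

end

open StatusUpdate in
theorem theorem2 {N M : ℕ} {R : Type*} [MeasurableSpace R]
    (ν : Measure R) [IsProbabilityMeasure ν]
    (μ : Measure ℝ≥0) [IsProbabilityMeasure μ] (hμ : IsNBU μ)
    (T : Traffic N) (hT : T.Synchronized) (a : Fin N → ℝ≥0)
    (P : Policy T M R) (hP : P.IsMASIFLGFS a)
    (p : ℝ≥0 → (Fin N → ℝ≥0) → ℝ) (hp : ∀ t, IsSymmPenalty (p t)) :
    (∀ π : Policy T M R,
      StochLE (law M ν μ) (P.servedAgePenalty a p) (law M ν μ) (π.agePenalty a p)) ∧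
    (∀ φ : (ℝ≥0 → ℝ) → ℝ, MonotoneOn φ lebesgueFunctions →
      (ExpectationExists (law M ν μ) φ (P.servedAgePenalty a p) →
        expectation (law M ν μ) φ (P.servedAgePenalty a p) ≤
          ⨅ (π : Policy T M R) (_ : ExpectationExists (law M ν μ) φ (π.agePenalty a p)),
            expectation (law M ν μ) φ (π.agePenalty a p)) ∧
      (ExpectationExists (law M ν μ) φ (P.agePenalty a p) →
        (⨅ (π : Policy T M R) (_ : ExpectationExists (law M ν μ) φ (π.agePenalty a p)),
            expectation (law M ν μ) φ (π.agePenalty a p)) ≤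
          expectation (law M ν μ) φ (P.agePenalty a p))) := by
  refine ⟨fun π => ?_, fun φ hφ => ⟨fun hex => ?_, fun hex => iInf₂_le P hex⟩⟩
  · obtain ⟨G, hG, hle⟩ := hP.exists_coupling (ν := ν) hμ hT hp π
    exact stochLE_of_coupling hG hle
  · refine le_iInf₂ fun π hπ => ?_
    obtain ⟨G, hG, hle⟩ := hP.exists_coupling (ν := ν) hμ hT hp π
    exact expectation_le_of_coupling hG hle hφ hex hπ
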